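/- **Theorem 2 (Immediate Optimality in Separable Informational Environments).** *Environment.* Let $K\ge 1$ and let $\theta=(\theta_1,\dots,\theta_K)'\sim\mathcal N(\mu^0,V^0)$ be an unknown, persistent state vector, of which only $\theta_1$ is payoff-relevant. There are $K$ information sources; each observation of source $k$ has the form $X_k=\langle c_k,\theta\rangle+\epsilon_k$ with $\epsilon_k\sim\mathcal N(0,\sigma_k^2)$, $\sigma_k^2>0$, the error terms being independent of $\theta$, across sources and across observations. Let $C$ be the matrix with rows $c_k'$; assume that $C$ has full rank and that no proper subset of its rows spans the coordinate vector $e_1'$. For $q\in\mathbb Z_+^K$ let $f(q)$ be the posterior variance of $\theta_1$ after $q_k$ observations of each source $k$ (it does not depend on the realizations). *Decision problem.* Let $B\ge 1$. In each period $t=1,2,\dots$ the decision maker (DM) chooses $B$ sources, repetitions allowed, observes one new realization for each, and then takes an action $a_t$ in a measurable space $A_t$. An information acquisition strategy $S$ is a measurable map from histories of past realizations to blocks of $B$ sources; a decision strategy $A$ is a measurable map from histories of realizations, up to and including the current period, to actions. The payoff is $U(a_1,a_2,\dots;\theta_1)\in\mathbb R$ with $U$ an arbitrary measurable function. The expected payoff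 is $\mathbb E[U^+]-\mathbb E[U^-]\in[-\infty,+\infty]$, where $\infty-\infty$ is read as $-\infty$. A pair $(S,A)$ is optimal if no pair has a larger expected payoff. $S$ is myopic if in every period and at every history it prescribes a block which, added to the observations acquired so far, minimizes the posterior variance of $\theta_1$ among all blocks of $B$ sources. *Separability.* The environment is separable if there are convex functions $g_1,\dots,g_K:[0,\infty)\to(-\infty,+\infty]$ and a function $F$, strictly increasing on the set of values taken by $\sum_i g_i(q_i)$ for $q\in\mathbb Z_+^K$, such that $$f(q_1,\dots,q_K)=F\big(g_1(q_1)+\dots+g_K(q_K)\big)\qquad\text{for all } q\in\mathbb Z_+^K .$$ *Claim.* Suppose that the environment is separable. Then for every $B\ge 1$ there is an information acquisition strategy $S$, myopic from period $1$, that is optimal in every decision problem $\big((A_t)_{t\ge1},U\big)$ in the following sense: 1. for every strategy $(S',A')$, the expected payoff of $(S',A')$ is at most the supremum, over decision strategies $A$, of the expected payoff of $(S,A)$; 2. for every strategy $(S',A')$ whose expected payoff is not $+\infty$ there is a decision strategy $A$ such that the expected payoff of $(S,A)$ is at least that of $(S',A')$; 3. consequently, if the decision problem has an optimal strategy with expected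 payoff other than $+\infty$, then it has an optimal strategy $(S,A)$ that acquires information by the myopic rule $S$. -/

import Mathlib

open MeasureTheory ProbabilityTheory
open scoped NNReal ENNReal

noncomputable section

/-- An informational environment with `K` unknown states and `K` information sources: the prior
`N(μ₀, V₀)` of the state vector, the coefficient matrix `C` whose `k`-th row is the coefficient
vector of source `k`, and the positive noise variances. The payoff-relevant state is the one with
index `0`. -/
structure InfoEnv (K : ℕ) where
  priorMean : EuclideanSpace ℝ (Fin K)
  priorCov : Matrix (Fin K) (Fin K) ℝ
  coeff : Matrix (Fin K) (Fin K) ℝ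
  noiseVar : Fin K → ℝ≥0
  priorCov_posSemidef : priorCov.PosSemidef
  noiseVar_pos : ∀ k, 0 < noiseVar k

/-- An information acquisition strategy with block size `B`: after `t` periods, as a measurable
function of the `t * B` realizations observed so far, it prescribes the sources of the `B`
observations of the next period (repetitions allowed). Earlier choices are not listed in the
history because the strategy determines them from the earlier realizations. -/
structure AcqStrategy (K B : ℕ) where
  choose : (t : ℕ) → (Fin t → Fin B → ℝ) → (Fin B → Fin K)
  measurable_choose : ∀ t, Measurable (choose t)

/-- A decision strategy: the action of each period is a measurable function of the realizations
observed up to and including that period. -/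
structure DecisionStrategy (B : ℕ) (Act : ℕ → Type*) [∀ t, MeasurableSpace (Act t)] where
  act : (t : ℕ) → (Fin (t + 1) → Fin B → ℝ) → Act t
  measurable_act : ∀ t, Measurable (act t)

/-- The number of times each source occurs in a block. -/
def blockCount {K B : ℕ} (s : Fin B → Fin K) (k : Fin K) : ℕ :=
  (Finset.univ.filter fun b => s b = k).card

/-- The division vector: how many observations of each source the strategy has acquired in the
first `t` periods along the history `h`. -/
def AcqStrategy.division {K B : ℕ} (S : AcqStrategy K B) (t : ℕ) (h : Fin t → Fin B → ℝ)
    (k : Fin K) : ℕ :=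
  ∑ s : Fin t, blockCount (S.choose s fun i => h (Fin.castLE s.isLt.le i)) k

namespace InfoEnv

variable {K : ℕ} (E : InfoEnv K)

/-- Non-redundancy: `C` has full rank, and no proper subset of its rows spans the first coordinate
vector. -/
def NonRedundant [NeZero K] : Prop :=
  IsUnit E.coeff.det ∧
    ∀ T : Set (Fin K), T ≠ Set.univ →
      (Pi.single 0 1 : Fin K → ℝ) ∉ Submodule.span ℝ (E.coeff '' T)

/-- The prior distribution of the state vector. -/
def prior : Measure (EuclideanSpace ℝ (Fin K)) :=
  multivariateGaussian E.priorMean E.priorCov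

/-- `⟨c_k, θ⟩`, the mean of source `k` in state `θ`. -/
def signalMean (θ : EuclideanSpace ℝ (Fin K)) (k : Fin K) : ℝ :=
  ∑ j, E.coeff k j * θ j

/-! ### The posterior variance function -/

/-- The joint law of the state vector and of the independent errors of `q k` observations of each
source `k`. -/
def sampleLaw (q : Fin K → ℕ) :
    Measure (EuclideanSpace ℝ (Fin K) × ((k : Fin K) → Fin (q k) → ℝ)) :=
  E.prior.prod (Measure.pi fun k => Measure.pi fun _ => gaussianReal 0 (E.noiseVar k))

/-- The values of `q k` observations of each source `k`. -/
def sampleObs (q : Fin K → ℕ) (ω : EuclideanSpace ℝ (Fin K) × ((k : Fin K) → Fin (q k) → ℝ)) :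
    (k : Fin K) → Fin (q k) → ℝ :=
  fun k j => E.signalMean ω.1 k + ω.2 k j

/-- The posterior variance of the payoff-relevant state after `q k` observations of each source
`k`. In this Gaussian model the conditional variance is almost surely constant; its mean is that
constant. -/
def posteriorVar [NeZero K] (q : Fin K → ℕ) : ℝ :=
  ∫ ω, (Var[fun ω => ω.1 0; E.sampleLaw q |
    MeasurableSpace.comap (E.sampleObs q) inferInstance]) ω ∂(E.sampleLaw q)

/-- Separability of the environment: `f q = F (∑ i, g i (q i))` with convex `g i` on `[0, ∞)` and
`F` strictly increasing (on the values that the sum takes). The `g i` may take the value `+∞`, as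
for `g i x = σ² / x` with `g i 0 = +∞`; convexity is convexity of the epigraph. -/
def Separable [NeZero K] : Prop :=
  ∃ (g : Fin K → ℝ → EReal) (F : EReal → ℝ),
    (∀ i x, 0 ≤ x → g i x ≠ ⊥) ∧
    (∀ i, Convex ℝ {p : ℝ × ℝ | 0 ≤ p.1 ∧ g i p.1 ≤ (p.2 : EReal)}) ∧
    StrictMonoOn F (Set.range fun q : Fin K → ℕ => ∑ i, g i (q i : ℝ)) ∧
    ∀ q : Fin K → ℕ, E.posteriorVar q = F (∑ i, g i (q i : ℝ))

/-- A strategy is myopic if in every period, at every history, the prescribed block, combined with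
the observations acquired so far, leads to the lowest posterior variance of the payoff-relevant
state among all blocks of `B` sources. -/
def IsMyopic [NeZero K] {B : ℕ} (S : AcqStrategy K B) : Prop :=
  ∀ (t : ℕ) (h : Fin t → Fin B → ℝ) (s : Fin B → Fin K),
    E.posteriorVar (S.division t h + blockCount (S.choose t h)) ≤
      E.posteriorVar (S.division t h + blockCount s)

/-! ### The dynamic decision problem -/

/-- The joint law of the state vector and of all the errors: the error of an observation of source
`k` made in period `t` as the `b`-th one of its block is the coordinate `(t, b, k)`, and all of
them are independent. -/
def law (B : ℕ) : Measure (EuclideanSpace ℝ (Fin K) × (ℕ → Fin B → Fin K → ℝ)) :=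
  E.prior.prod (Measure.infinitePi fun _ : ℕ =>
    Measure.pi fun _ : Fin B => Measure.pi fun k => gaussianReal 0 (E.noiseVar k))

/-- The realizations observed in the first `t` periods under the strategy `S`. -/
def history {B : ℕ} (S : AcqStrategy K B)
    (ω : EuclideanSpace ℝ (Fin K) × (ℕ → Fin B → Fin K → ℝ)) : (t : ℕ) → Fin t → Fin B → ℝ
  | 0 => Fin.elim0
  | t + 1 => Fin.snoc (α := fun _ => Fin B → ℝ) (history S ω t) fun b =>
      E.signalMean ω.1 (S.choose t (history S ω t) b) +
        ω.2 t b (S.choose t (history S ω t) b)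

variable {B : ℕ} {Act : ℕ → Type*} [∀ t, MeasurableSpace (Act t)]

/-- The realized payoff of the strategy `(S, A)` in the decision problem with payoff function `U`
of the sequence of actions and the payoff-relevant state. -/
def payoff [NeZero K] (U : ((t : ℕ) → Act t) → ℝ → ℝ) (S : AcqStrategy K B)
    (A : DecisionStrategy B Act)
    (ω : EuclideanSpace ℝ (Fin K) × (ℕ → Fin B → Fin K → ℝ)) : ℝ :=
  U (fun t => A.act t (E.history S ω (t + 1))) (ω.1 0)

/-- The expected payoff, as the extended real number `E[U⁺] - E[U⁻]`; an undefined expectation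
`∞ - ∞` counts as `-∞`. -/
def expectedPayoff [NeZero K] (U : ((t : ℕ) → Act t) → ℝ → ℝ) (S : AcqStrategy K B)
    (A : DecisionStrategy B Act) : EReal :=
  ((∫⁻ ω, ENNReal.ofReal (E.payoff U S A ω) ∂(E.law B) : ℝ≥0∞) : EReal) -
    ((∫⁻ ω, ENNReal.ofReal (-E.payoff U S A ω) ∂(E.law B) : ℝ≥0∞) : EReal)

/-- The strategy `(S, A)` is optimal: no strategy has a larger expected payoff. -/
def IsOptimal [NeZero K] (U : ((t : ℕ) → Act t) → ℝ → ℝ) (S : AcqStrategy K B)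
    (A : DecisionStrategy B Act) : Prop :=
  ∀ (S' : AcqStrategy K B) (A' : DecisionStrategy B Act),
    E.expectedPayoff U S' A' ≤ E.expectedPayoff U S A

end InfoEnv

end

/-! The proof combines a greedy argument with a comparison of Gaussian experiments.

Convexity makes the increments of each `g i` nondecreasing, so adding one observation at a time
where the increment is smallest minimizes `∑ i, g i (q i)` among all `q` of the same total,
simultaneously for every total. Hence one fixed sequence of sources minimizes the posterior variance
at every sample size (`Separable.exists_seqCount_minimizes`). Cutting it into blocks of `B` gives
the myopic strategy `S`; it is deterministic, so its posterior variance `w t` after `t` periods is a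
constant.

Under any rival `S'` the payoff-relevant state is, given the history, again Gaussian, with a
variance `v'` that may depend on the history (`exists_condGaussian_history`) but is at least `w t`,
since the totals agree. Consider the mean `m'` of that law plus independent noise of variance `v' -
w t`. A further independent noise of variance `w t` turns it into a copy of the state, so it stands
to the state as the posterior mean under `S` does. Drawing the next block of `S'` from its
conditional law given the simulated past and the actual posterior mean under `S` therefore yields
the right joint law with the state (`exists_simulation_step`). Iterating with fresh uniform
variables, without revising earlier draws, simulates the whole history of `S'` in real time
(`exists_simulation`, `map_histories_eq`).

Feeding the simulated history to the rival decision rule gives a randomized decision strategy along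
`S` with the same expected payoff. Some realization of the randomization does at least as well as
any real lower bound of the average (`exists_le_sub_of_le_lintegral_sub`), which removes the
randomness. -/

noncomputable section

/-! ### Greedy minimization of separable convex functions -/

/-- How often each index occurs among the first `n` terms of a sequence. -/
def seqCount {ι : Type*} [DecidableEq ι] (j : ℕ → ι) (n : ℕ) (i : ι) : ℕ :=
  ((Finset.range n).filter fun a => j a = i).card

lemma seqCount_succ {ι : Type*} [DecidableEq ι] (j : ℕ → ι) (n : ℕ) :
    seqCount j (n + 1) = Function.update (seqCount j n) (j n) (seqCount j n (j n) + 1) := by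
  ext i
  unfold seqCount
  rw [Finset.range_add_one, Finset.filter_insert]
  rcases eq_or_ne (j n) i with h | h
  · subst h; simp
  · simp [h, Function.update_of_ne h.symm]

lemma sum_update_add_one {ι L : Type*} [Fintype ι] [DecidableEq ι] [AddCommGroup L]
    (G : ι → ℕ → L) (q : ι → ℕ) (i : ι) :
    ∑ k, G k (Function.update q i (q i + 1) k) =
      ∑ k, G k (q k) + (G i (q i + 1) - G i (q i)) := by
  rw [← Finset.add_sum_erase _ _ (Finset.mem_univ i),
    ← Finset.add_sum_erase Finset.univ (fun k => G k (q k)) (Finset.mem_univ i)]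
  have : ∑ k ∈ Finset.univ.erase i, G k (Function.update q i (q i + 1) k) =
      ∑ k ∈ Finset.univ.erase i, G k (q k) :=
    Finset.sum_congr rfl fun k hk => by rw [Function.update_of_ne (Finset.ne_of_mem_erase hk)]
  rw [this, Function.update_self]
  abel

lemma sum_update_succ {ι : Type*} [Fintype ι] [DecidableEq ι] (q : ι → ℕ) (i : ι) :
    ∑ k, Function.update q i (q i + 1) k = ∑ k, q k + 1 := by
  have h := sum_update_add_one (fun _ (a : ℕ) => (a : ℤ)) q i
  zify
  rw [h]
  push_cast
  ring

/-- If each `G i` has nondecreasing increments, the greedy sequence of indices minimizes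
`∑ i, G i (q i)` among all `q` with the same total, at every length. -/
lemma exists_seqCount_minimizes {ι L : Type*} [Fintype ι] [DecidableEq ι] [Nonempty ι]
    [AddCommGroup L] [LinearOrder L] [IsOrderedAddMonoid L] (G : ι → ℕ → L)
    (hG : ∀ i, Monotone fun n => G i (n + 1) - G i n) :
    ∃ j : ℕ → ι, ∀ (n : ℕ) (q : ι → ℕ), ∑ i, q i = n →
      ∑ i, G i (seqCount j n i) ≤ ∑ i, G i (q i) := by
  choose next hnext using fun m : ι → ℕ => Finite.exists_min fun i => G i (m i + 1) - G i (m i)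
  let path : ℕ → ι → ℕ := fun n =>
    Nat.rec 0 (fun _ m => Function.update m (next m) (m (next m) + 1)) n
  have hpath : ∀ n, path (n + 1) =
      Function.update (path n) (next (path n)) (path n (next (path n)) + 1) := fun n => rfl
  let j : ℕ → ι := fun n => next (path n)
  have hj : ∀ n, seqCount j n = path n := by
    intro n
    induction n with
    | zero => ext i; simp [seqCount, path]
    | succ n ih => rw [seqCount_succ, ih, hpath]
  have htot : ∀ n, ∑ i, path n i = n := by
    intro n
    induction n with
    | zero => simp [path]
    | succ n ih =>
      rw [hpath, sum_update_succ, ih]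
  refine ⟨j, fun n => ?_⟩
  simp only [hj]
  induction n with
  | zero =>
    intro q hq
    have : q = 0 := by
      ext i
      exact (Finset.sum_eq_zero_iff.1 hq) i (Finset.mem_univ i)
    rw [this]
    rfl
  | succ n ih =>
    intro q hq
    -- Exchange argument: `q` has a larger total than the greedy vector, so it exceeds it at some
    -- `i`. One unit is removed there. The removed increment is at least the increment at `path n
    -- i`, which is at least the smallest one, the one taken by the greedy step.
    obtain ⟨i, hi⟩ : ∃ i, path n i < q i := by
      by_contra! h
      have := Finset.sum_le_sum fun i (_ : i ∈ Finset.univ) => h i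
      rw [hq, htot] at this
      omega
    let q' := Function.update q i (q i - 1)
    have hqq : q = Function.update q' i (q' i + 1) := by
      simp only [q', Function.update_self, Function.update_idem]
      rw [Nat.sub_add_cancel (by omega), Function.update_eq_self]
    have hq' : ∑ k, q' k = n := by
      have h := sum_update_succ q' i
      rw [← hqq, hq] at h
      omega
    have h1 : path n i ≤ q' i := by simp only [q', Function.update_self]; omega
    rw [hpath, sum_update_add_one]
    conv_rhs => rw [hqq, sum_update_add_one]
    exact add_le_add (ih q' hq') ((hnext (path n) i).trans (hG i h1))

/-- A convex function on the naturals with values in `(-∞, +∞]` that is not identically `+∞`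
is represented by a function with nondecreasing increments in the lexicographic plane, whose first
coordinate is minimal exactly where the function is finite. -/
lemma exists_lex_representation (g : ℕ → EReal)
    (hconv : ∀ a b c : ℕ, a ≤ b → b ≤ c → g a ≠ ⊤ → g c ≠ ⊤ → g b ≠ ⊤)
    (hmid : ∀ n, g n ≠ ⊤ → g (n + 1) ≠ ⊤ → g (n + 2) ≠ ⊤ →
      (g (n + 1)).toReal - (g n).toReal ≤ (g (n + 2)).toReal - (g (n + 1)).toReal)
    (hne : ∃ n, g n ≠ ⊤) :
    ∃ (G : ℕ → ℝ ×ₗ ℝ) (a b : ℝ), Monotone (fun n => G (n + 1) - G n) ∧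
      (∀ n, a ≤ (ofLex (G n)).1) ∧
      (∀ n, (ofLex (G n)).1 = a ↔ g n ≠ ⊤) ∧
      (∀ n, g n ≠ ⊤ → (ofLex (G n)).2 = (g n).toReal - b) := by
  classical
  let a := Nat.find hne
  have ha : g a ≠ ⊤ := Nat.find_spec hne
  have ha' : ∀ n, n < a → g n = ⊤ := fun n hn => not_not.1 (Nat.find_min hne hn)
  -- The prescribed increments are `(-1, 0)` before the first finite point, the true increments in
  -- the second coordinate on the finite stretch, and `(1, 0)` beyond it: nondecreasing in the
  -- lexicographic order. The first coordinate of their partial sums falls to `-a`, stays there on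
  -- the finite stretch and then rises.
  let D : ℕ → ℝ × ℝ := fun n =>
    if n < a then (-1, 0) else if g (n + 1) ≠ ⊤ then (0, (g (n + 1)).toReal - (g n).toReal)
    else (1, 0)
  have hfin : ∀ n, a ≤ n → g (n + 1) ≠ ⊤ → g n ≠ ⊤ := fun n h1 h2 =>
    hconv a n (n + 1) h1 (by omega) ha h2
  let G : ℕ → ℝ × ℝ := fun n => ∑ y ∈ Finset.range n, D y
  have hG : ∀ n, G (n + 1) - G n = D n := fun n => by
    simp only [G, Finset.sum_range_succ]; abel
  have hG' : ∀ n, G (n + 1) = G n + D n := fun n => by simp only [G, Finset.sum_range_succ]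
  have hlow : ∀ n, n ≤ a → G n = (-(n : ℝ), 0) := by
    intro n
    induction n with
    | zero => intro _; simp [G]; rfl
    | succ n ih =>
      intro h
      rw [hG', ih (by omega)]
      simp only [D, if_pos (show n < a by omega)]
      ext <;> simp
      ring
  have hhigh : ∀ n, a ≤ n →
      (g n ≠ ⊤ → G n = (-(a : ℝ), (g n).toReal - (g a).toReal)) ∧
      (g n = ⊤ → -(a : ℝ) < (G n).1) := by
    intro n hn
    induction n, hn using Nat.le_induction with
    | base => exact ⟨fun _ => by rw [hlow a le_rfl]; simp, fun h => absurd h ha⟩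
    | succ n hn ih =>
      have hna : ¬ n < a := by omega
      constructor
      · intro h
        rw [hG', ih.1 (hfin n hn h)]
        simp only [D, if_neg hna, if_pos h]
        ext <;> simp
      · intro h
        rw [hG']
        simp only [D, if_neg hna, h, ne_eq, not_true_eq_false, if_false]
        by_cases h' : g n = ⊤
        · have := ih.2 h'
          simp only [Prod.fst_add]
          linarith
        · rw [ih.1 h']; simp
  refine ⟨fun n => toLex (G n), -a, (g a).toReal, ?_, ?_, ?_, ?_⟩
  · refine monotone_nat_of_le_succ fun n => ?_
    have e : ∀ n, toLex (G (n + 1)) - toLex (G n) = toLex (D n) := fun n => by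
      rw [← toLex_sub, hG]
    rw [e, e, Prod.Lex.toLex_le_toLex]
    simp only [D]
    by_cases h1 : n + 1 < a
    · simp [h1, show n < a by omega]
    · by_cases h2 : n < a
      · left
        by_cases h3 : g (n + 1 + 1) = ⊤ <;> simp [h1, h2, h3]
      · by_cases h3 : g (n + 1 + 1) = ⊤
        · by_cases h4 : g (n + 1) = ⊤ <;> simp [h1, h2, h3, h4]
        · have h4 : g (n + 1) ≠ ⊤ := hfin (n + 1) (by omega) h3
          right
          simp only [h1, h2, h3, h4, if_false, ne_eq, not_false_eq_true, if_true, true_and]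
          exact hmid n (hfin n (by omega) h4) h4 h3
  · intro n
    simp only [ofLex_toLex]
    rcases le_total n a with h | h
    · rw [hlow n h]; simpa using h
    · by_cases h' : g n = ⊤
      · exact ((hhigh n h).2 h').le
      · rw [(hhigh n h).1 h']
  · intro n
    simp only [ofLex_toLex]
    rcases lt_or_ge n a with h | h
    · rw [hlow n h.le]
      simp only [ne_eq, ha' n h, not_true_eq_false, iff_false, neg_inj, Nat.cast_inj]
      omega
    · by_cases h' : g n = ⊤
      · simp [h', ((hhigh n h).2 h').ne']
      · simp [(hhigh n h).1 h', h']
  · intro n hn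
    have h : a ≤ n := by
      by_contra h
      exact hn (ha' n (by omega))
    simp [(hhigh n h).1 hn]

/-- Greedy minimization of a separable sum of convex functions with values in `(-∞, +∞]`. -/
lemma exists_seqCount_minimizes_ereal {ι : Type*} [Fintype ι] [DecidableEq ι] [Nonempty ι]
    (g : ι → ℝ → EReal) (hbot : ∀ i x, 0 ≤ x → g i x ≠ ⊥)
    (hconv : ∀ i, Convex ℝ {p : ℝ × ℝ | 0 ≤ p.1 ∧ g i p.1 ≤ (p.2 : EReal)}) :
    ∃ j : ℕ → ι, ∀ (n : ℕ) (q : ι → ℕ), ∑ i, q i = n →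
      ∑ i, g i (seqCount j n i : ℝ) ≤ ∑ i, g i (q i : ℝ) := by
  have hb : ∀ i (n : ℕ), g i n ≠ ⊥ := fun i n => hbot i n n.cast_nonneg
  have sum_top : ∀ q : ι → ℕ, (∃ i, g i (q i) = ⊤) → ∑ i, g i (q i : ℝ) = ⊤ := by
    rintro q ⟨i, hi⟩
    rw [← Finset.add_sum_erase _ _ (Finset.mem_univ i), hi]
    refine EReal.top_add_of_ne_bot ?_
    exact Finset.sum_induction _ (· ≠ ⊥) (fun a b ha hb => by simp [EReal.add_eq_bot_iff, ha, hb])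
      (by simp) fun k _ => hb k (q k)
  have sum_fin : ∀ q : ι → ℕ, (∀ i, g i (q i) ≠ ⊤) →
      ∑ i, g i (q i : ℝ) = ((∑ i, (g i (q i)).toReal : ℝ) : EReal) := by
    intro q hq
    exact (Finset.sum_congr rfl fun i _ => (EReal.coe_toReal (hq i) (hb i (q i))).symm).trans
      (map_sum (⟨⟨Real.toEReal, EReal.coe_zero⟩, EReal.coe_add⟩ : ℝ →+ EReal) _ _).symm
  by_cases hne : ∀ i, ∃ n : ℕ, g i n ≠ ⊤
  swap
  · push Not at hne
    obtain ⟨i, hi⟩ := hne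
    refine ⟨fun _ => i, fun n q _ => ?_⟩
    rw [sum_top q ⟨i, hi _⟩]
    exact le_top
  have conv : ∀ i (a b c : ℕ), a ≤ b → b ≤ c → g i a ≠ ⊤ → g i c ≠ ⊤ → g i b ≠ ⊤ := by
    intro i a b c hab hbc ha hc
    rcases hab.eq_or_lt with rfl | hab
    · exact ha
    have h1 : ((a : ℝ), (g i a).toReal) ∈ {p : ℝ × ℝ | 0 ≤ p.1 ∧ g i p.1 ≤ (p.2 : EReal)} :=
      ⟨a.cast_nonneg, (EReal.coe_toReal ha (hb i a)).ge⟩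
    have h2 : ((c : ℝ), (g i c).toReal) ∈ {p : ℝ × ℝ | 0 ≤ p.1 ∧ g i p.1 ≤ (p.2 : EReal)} :=
      ⟨c.cast_nonneg, (EReal.coe_toReal hc (hb i c)).ge⟩
    have hab' : (a : ℝ) < b := by exact_mod_cast hab
    have hbc' : (b : ℝ) ≤ c := by exact_mod_cast hbc
    have hpos : (0 : ℝ) < c - a := by linarith
    have h3 := hconv i h1 h2 (a := (c - b) / (c - a)) (b := (b - a) / (c - a))
      (div_nonneg (by linarith) hpos.le) (div_nonneg (by linarith) hpos.le)
      (by field_simp; ring)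
    have e : (c - b : ℝ) / (c - a) * a + (b - a) / (c - a) * c = b := by field_simp; ring
    simp only [Set.mem_ofPred_eq, Prod.fst_add, Prod.smul_fst, smul_eq_mul, e] at h3
    exact ne_top_of_le_ne_top (EReal.coe_ne_top _) h3.2
  have mid : ∀ i (n : ℕ), g i n ≠ ⊤ → g i (n + 1 : ℕ) ≠ ⊤ → g i (n + 2 : ℕ) ≠ ⊤ →
      (g i (n + 1 : ℕ)).toReal - (g i n).toReal ≤
        (g i (n + 2 : ℕ)).toReal - (g i (n + 1 : ℕ)).toReal := by
    intro i n h0 h1 h2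
    have m1 : ((n : ℝ), (g i n).toReal) ∈ {p : ℝ × ℝ | 0 ≤ p.1 ∧ g i p.1 ≤ (p.2 : EReal)} :=
      ⟨n.cast_nonneg, (EReal.coe_toReal h0 (hb i n)).ge⟩
    have m2 : (((n + 2 : ℕ) : ℝ), (g i (n + 2 : ℕ)).toReal) ∈
        {p : ℝ × ℝ | 0 ≤ p.1 ∧ g i p.1 ≤ (p.2 : EReal)} :=
      ⟨Nat.cast_nonneg _, (EReal.coe_toReal h2 (hb i _)).ge⟩
    have h3 := hconv i m1 m2 (a := 1 / 2) (b := 1 / 2) (by norm_num) (by norm_num) (by norm_num)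
    have e : (1 / 2 : ℝ) * n + 1 / 2 * ((n + 2 : ℕ) : ℝ) = ((n + 1 : ℕ) : ℝ) := by
      push_cast; ring
    simp only [Set.mem_ofPred_eq, Prod.fst_add, Prod.snd_add, Prod.smul_fst, Prod.smul_snd,
      smul_eq_mul, e] at h3
    have h4 := h3.2
    rw [← EReal.coe_toReal h1 (hb i _), EReal.coe_le_coe_iff] at h4
    linarith
  choose G a b hmono hle hiff hsnd using fun i =>
    exists_lex_representation (fun n => g i n) (conv i) (mid i) (hne i)
  obtain ⟨j, hj⟩ := exists_seqCount_minimizes G hmono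
  refine ⟨j, fun n q hq => ?_⟩
  by_cases hqf : ∀ i, g i (q i) ≠ ⊤
  swap
  · push Not at hqf
    rw [sum_top q hqf]
    exact le_top
  have ofLex_sum : ∀ p : ι → ℕ, ofLex (∑ i, G i (p i)) = ∑ i, ofLex (G i (p i)) := fun p =>
    map_sum (⟨⟨ofLex, rfl⟩, fun _ _ => rfl⟩ : (ℝ ×ₗ ℝ) →+ ℝ × ℝ) _ _
  have h := hj n q hq
  rw [Prod.Lex.le_iff, ofLex_sum, ofLex_sum] at h
  simp only [Prod.fst_sum, Prod.snd_sum] at h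
  -- Finiteness at `q` puts the sum of first coordinates at its lower bound. The greedy vector is
  -- lexicographically no larger, so it attains the bound too, is finite in every coordinate, and
  -- compares through the second coordinates.
  have hq1 : ∑ i, (ofLex (G i (q i))).1 = ∑ i, a i :=
    Finset.sum_congr rfl fun i _ => (hiff i _).2 (hqf i)
  have hm1 : ∑ i, a i ≤ ∑ i, (ofLex (G i (seqCount j n i))).1 :=
    Finset.sum_le_sum fun i _ => hle i _
  rcases h with h | ⟨h1, h2⟩
  · linarith
  have hmf : ∀ i, g i (seqCount j n i) ≠ ⊤ := by
    have := (Finset.sum_eq_sum_iff_of_le fun i _ => hle i (seqCount j n i)).1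
      (hq1.symm.trans h1.symm)
    exact fun i => (hiff i _).1 (this i (Finset.mem_univ i)).symm
  rw [sum_fin _ hmf, sum_fin q hqf, EReal.coe_le_coe_iff]
  rw [Finset.sum_congr rfl fun i _ => hsnd i _ (hmf i),
    Finset.sum_congr rfl fun i _ => hsnd i _ (hqf i), Finset.sum_sub_distrib,
    Finset.sum_sub_distrib] at h2
  linarith

namespace InfoEnv

/-- In a separable environment some sequence of sources minimizes the posterior variance at every
sample size. -/
lemma Separable.exists_seqCount_minimizes {K : ℕ} [NeZero K] {E : InfoEnv K} (h : E.Separable) :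
    ∃ j : ℕ → Fin K, ∀ (n : ℕ) (q : Fin K → ℕ), ∑ i, q i = n →
      E.posteriorVar (seqCount j n) ≤ E.posteriorVar q := by
  obtain ⟨g, F, hbot, hconv, hF, hf⟩ := h
  obtain ⟨j, hj⟩ := exists_seqCount_minimizes_ereal g hbot hconv
  refine ⟨j, fun n q hq => ?_⟩
  rw [hf, hf]
  exact hF.monotoneOn ⟨_, rfl⟩ ⟨_, rfl⟩ (hj n q hq)

end InfoEnv

/-! ### Conditioning in Gaussian families -/

section Conditioning

variable {Ω ι : Type*} [MeasurableSpace Ω] [Fintype ι] {P : Measure Ω}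

/-- The normal equations are solvable even for a singular covariance matrix: its range is the
orthogonal complement of its kernel, and a kernel vector gives a combination of the `X i` with zero
variance, almost surely constant and so uncorrelated with `Y`. -/
lemma exists_uncorrelated_residual [IsProbabilityMeasure P] {X : ι → Ω → ℝ} {Y : Ω → ℝ}
    (hX : ∀ i, MemLp (X i) 2 P) (hY : MemLp Y 2 P) :
    ∃ w : ι → ℝ, ∀ i, cov[X i, fun ω => Y ω - ∑ j, w j * X j ω; P] = 0 := by
  classical
  let A : Matrix ι ι ℝ := Matrix.of fun i j => cov[X i, X j; P]
  let T := Matrix.toEuclideanLin A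
  have hT : T.IsSymmetric := by
    refine Matrix.isSymmetric_toEuclideanLin_iff.2 ?_
    ext i j
    simp [A, covariance_comm]
  have hTapp : ∀ (u : EuclideanSpace ℝ ι) i, T u i = cov[X i, fun ω => ∑ j, u j * X j ω; P] := by
    intro u i
    rw [covariance_fun_sum_right (fun j => (hX j).const_mul _) (hX i)]
    simp [T, A, Matrix.mulVec, dotProduct, covariance_const_mul_right,
      mul_comm (u.ofLp _) (cov[_, _; _])]
  let b : EuclideanSpace ℝ ι := WithLp.toLp 2 fun i => cov[X i, Y; P]
  have hb : b ∈ LinearMap.range T := by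
    rw [← Submodule.orthogonal_orthogonal (LinearMap.range T), hT.orthogonal_range,
      Submodule.mem_orthogonal]
    intro u hu
    rw [LinearMap.mem_ker] at hu
    let Z : Ω → ℝ := fun ω => ∑ j, u j * X j ω
    have hZ : MemLp Z 2 P := memLp_finsetSum _ fun j _ => (hX j).const_mul _
    have h0 : ∀ i, cov[X i, Z; P] = 0 := fun i => by rw [← hTapp, hu]; rfl
    have hvar : Var[Z; P] = 0 := by
      rw [← covariance_self hZ.aemeasurable]
      change cov[fun ω => ∑ j, u j * X j ω, Z; P] = 0
      rw [covariance_fun_sum_left (fun j => (hX j).const_mul _) hZ]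
      simp [covariance_const_mul_left, h0]
    have hc := ae_eq_integral_of_variance_eq_zero hZ hvar
    have : cov[Z, Y; P] = 0 := by
      rw [covariance, integral_eq_zero_of_ae]
      filter_upwards [hc] with ω hω
      simp [hω]
    rw [← this]
    change _ = cov[fun ω => ∑ j, u j * X j ω, Y; P]
    rw [covariance_fun_sum_left (fun j => (hX j).const_mul _) hY]
    simp [PiLp.inner_apply, b, covariance_const_mul_left, mul_comm (u.ofLp _) (cov[_, _; _])]
  obtain ⟨w, hw⟩ := hb
  refine ⟨w, fun i => ?_⟩
  rw [covariance_fun_sub_right (hX i) hY (memLp_finsetSum _ fun j _ => (hX j).const_mul _),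
    ← hTapp, hw]
  simp [b]

/-- In a Gaussian family, a real variable is a measurable function of the others plus an independent
centered Gaussian residual. -/
lemma ProbabilityTheory.HasGaussianLaw.exists_indepFun_residual {X : ι → Ω → ℝ} {Y : Ω → ℝ}
    (h : HasGaussianLaw (fun ω => (fun i => X i ω, Y ω)) P) :
    ∃ (m : (ι → ℝ) → ℝ) (v : ℝ≥0), Measurable m ∧
      IndepFun (fun ω i => X i ω) (fun ω => Y ω - m fun i => X i ω) P ∧
      P.map (fun ω => Y ω - m fun i => X i ω) = gaussianReal 0 v := by
  have := h.isProbabilityMeasure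
  have hX : ∀ i, MemLp (X i) 2 P := fun i => (h.fst.eval i).memLp_two
  obtain ⟨w, hw⟩ := exists_uncorrelated_residual hX h.snd.memLp_two
  let R : Ω → ℝ := fun ω => Y ω - ∑ j, w j * X j ω
  -- The residual is made a family over `Unit` because the independence criterion compares
  -- covariances of two families.
  let L : (ι → ℝ) × ℝ →L[ℝ] (ι → ℝ) × (Unit → ℝ) :=
    (ContinuousLinearMap.fst ℝ _ _).prod (ContinuousLinearMap.pi fun _ =>
      ContinuousLinearMap.snd ℝ _ _ -
        (∑ j, w j • ContinuousLinearMap.proj (R := ℝ) (φ := fun _ : ι => ℝ) j).comp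
          (ContinuousLinearMap.fst ℝ _ _))
  have hXR : HasGaussianLaw (fun ω => (fun i => X i ω, fun _ : Unit => R ω)) P := by
    have e : (fun ω => (fun i => X i ω, fun _ : Unit => R ω)) =
        fun ω => L (fun i => X i ω, Y ω) := by
      ext <;> simp [L, R]
    rw [e]
    exact h.map_fun L
  have hind := (hXR.indepFun_of_covariance_eval (X := X) (Y := fun _ => R) fun i _ => hw i)
  have hR : HasGaussianLaw R P := hXR.snd.eval ()
  refine ⟨fun x => ∑ j, w j * x j + P[R], Var[R; P].toNNReal, by fun_prop, ?_, ?_⟩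
  · have e : (fun ω => Y ω - (∑ j, w j * X j ω + P[R])) =
        (fun f : Unit → ℝ => f () - P[R]) ∘ fun ω _ => R ω := by
      ext ω
      simp only [R, Function.comp]
      ring
    rw [e]
    exact hind.comp (φ := id) measurable_id (by fun_prop)
  · have e : (fun ω => Y ω - (∑ j, w j * X j ω + P[R])) = (fun x => x - P[R]) ∘ R := by
      ext ω
      simp only [R, Function.comp]
      ring
    rw [e, ← AEMeasurable.map_map_of_aemeasurable (by fun_prop) hR.aemeasurable,
      hR.map_eq_gaussianReal, gaussianReal_map_sub_const]
    simp

/-- A centered residual independent of `X` makes `m X` the conditional expectation, so the mean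
conditional variance is the second moment of the residual. This ties `posteriorVar` to the Gaussian
decomposition. -/
lemma integral_condVar_of_indepFun_residual {X' : Type*} [MeasurableSpace X']
    {X : Ω → X'} {Y : Ω → ℝ} {m : X' → ℝ} {v : ℝ≥0} (hX : Measurable X) (hY : Measurable Y)
    (hm : Measurable m) [IsProbabilityMeasure P] (hYint : Integrable Y P)
    (hind : IndepFun X (fun ω => Y ω - m (X ω)) P)
    (hR : P.map (fun ω => Y ω - m (X ω)) = gaussianReal 0 v) :
    ∫ ω, (Var[Y; P | MeasurableSpace.comap X inferInstance]) ω ∂P = v := by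
  have hle : MeasurableSpace.comap X inferInstance ≤ (inferInstance : MeasurableSpace Ω) :=
    hX.comap_le
  let R : Ω → ℝ := fun ω => Y ω - m (X ω)
  have hRm : Measurable R := by fun_prop
  have hRlaw : HasGaussianLaw R P := ⟨by rw [hR]; infer_instance⟩
  have hRint : Integrable R P := hRlaw.integrable
  have hmX : Integrable (fun ω => m (X ω)) P := by
    have : (fun ω => m (X ω)) = fun ω => Y ω - R ω := by ext ω; simp [R]
    rw [this]
    exact hYint.sub hRint
  have hRmean : P[R] = 0 := by
    have := integral_map hRm.aemeasurable (μ := P) (f := fun x : ℝ => x) (by fun_prop)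
    rw [← this, hR, integral_id_gaussianReal]
  have hcond : P[Y | MeasurableSpace.comap X inferInstance] =ᵐ[P] fun ω => m (X ω) := by
    have h1 : Y = (fun ω => m (X ω)) + R := by ext ω; simp [R]
    have h2 := condExp_add hmX hRint (MeasurableSpace.comap X inferInstance)
    have h3 : P[fun ω => m (X ω) | MeasurableSpace.comap X inferInstance] = fun ω => m (X ω) :=
      condExp_of_stronglyMeasurable hle
        (hm.comp (comap_measurable X)).stronglyMeasurable hmX
    have h4 : P[R | MeasurableSpace.comap X inferInstance] =ᵐ[P] fun _ => P[R] :=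
      condExp_indep_eq hRm.comap_le hle (comap_measurable R).stronglyMeasurable hind.symm
    rw [h1]
    filter_upwards [h2, h4] with ω h2 h4
    rw [h2, Pi.add_apply, h3, h4, hRmean, add_zero]
  rw [condVar, integral_condExp hle]
  calc ∫ ω, ((Y - P[Y | MeasurableSpace.comap X inferInstance]) ^ 2) ω ∂P
      = ∫ ω, R ω ^ 2 ∂P := by
        refine integral_congr_ae ?_
        filter_upwards [hcond] with ω h
        simp [h, R]
    _ = Var[R; P] := (variance_of_integral_eq_zero hRm.aemeasurable hRmean).symm
    _ = v := by
        rw [← variance_id_map hRm.aemeasurable, hR, variance_id_gaussianReal]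

/-- The conditional law of `Y` given `X` is Gaussian, with mean `m X` and variance `v X`. -/
def CondGaussian {X' : Type*} [MeasurableSpace X'] (P : Measure Ω) (X : Ω → X') (Y : Ω → ℝ)
    (m v : X' → ℝ) : Prop :=
  P.map (fun ω => (X ω, Y ω)) =
    ((P.map X).prod (gaussianReal 0 1)).map fun p => (p.1, m p.1 + √(v p.1) * p.2)

lemma gaussianReal_map_sqrt_mul (v : ℝ≥0) :
    (gaussianReal 0 1).map (fun z => √(v : ℝ) * z) = gaussianReal 0 v := by
  rw [gaussianReal_map_const_mul]
  congr 1
  · simp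
  · ext; simp

lemma condGaussian_of_indepFun_residual {X' : Type*} [MeasurableSpace X']
    {X : Ω → X'} {Y : Ω → ℝ} {m : X' → ℝ} {v : ℝ≥0} (hX : Measurable X) (hY : Measurable Y)
    (hm : Measurable m) [IsProbabilityMeasure P]
    (hind : IndepFun X (fun ω => Y ω - m (X ω)) P)
    (hR : P.map (fun ω => Y ω - m (X ω)) = gaussianReal 0 v) :
    CondGaussian P X Y m fun _ => v := by
  have h1 := (indepFun_iff_map_prod_eq_prod_map_map hX.aemeasurable
    (by fun_prop : Measurable fun ω => Y ω - m (X ω)).aemeasurable).1 hind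
  have hfun : (fun ω => (X ω, Y ω)) =
      (fun p : X' × ℝ => (p.1, m p.1 + p.2)) ∘ fun ω => (X ω, Y ω - m (X ω)) := by
    ext ω <;> simp
  have hprob : IsProbabilityMeasure (P.map X) := Measure.isProbabilityMeasure_map hX.aemeasurable
  have h2 : (P.map X).prod (gaussianReal 0 v) =
      ((P.map X).prod (gaussianReal 0 1)).map (Prod.map id fun z => √(v : ℝ) * z) := by
    rw [← Measure.map_prod_map _ _ measurable_id (by fun_prop), Measure.map_id,
      gaussianReal_map_sqrt_mul]
  rw [CondGaussian, hfun, ← Measure.map_map (by fun_prop) (by fun_prop), h1, hR, h2,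
    Measure.map_map (by fun_prop) (by fun_prop)]
  rfl

end Conditioning

/-! ### Transport and gluing of Gaussian conditional laws -/

section CondGaussian

variable {Ω : Type*} [MeasurableSpace Ω] {P : Measure Ω} {X' : Type*} [MeasurableSpace X']
  {X : Ω → X'} {Y : Ω → ℝ} {m v : X' → ℝ}

lemma CondGaussian.of_map_eq {Ω' : Type*} [MeasurableSpace Ω'] {P' : Measure Ω'} {Z : Ω' → X'}
    {Y' : Ω' → ℝ} (h : CondGaussian P X Y m v) (hX : Measurable X) (hY : Measurable Y)
    (hZ : Measurable Z) (hY' : Measurable Y')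
    (heq : P'.map (fun ω => (Z ω, Y' ω)) = P.map fun ω => (X ω, Y ω)) :
    CondGaussian P' Z Y' m v := by
  have hfst := congrArg (Measure.map Prod.fst) heq
  rw [Measure.map_map (by fun_prop) (by fun_prop), Measure.map_map (by fun_prop) (by fun_prop)]
    at hfst
  change P'.map Z = P.map X at hfst
  rw [CondGaussian, heq, hfst]
  exact h

lemma CondGaussian.map_equiv {X'' : Type*} [MeasurableSpace X''] [SFinite P] (e : X' ≃ᵐ X'')
    (h : CondGaussian P X Y m v) (hX : Measurable X) (hY : Measurable Y) (hm : Measurable m)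
    (hv : Measurable v) :
    CondGaussian P (fun ω => e (X ω)) Y (fun x => m (e.symm x)) fun x => v (e.symm x) := by
  have h1 : P.map (fun ω => (e (X ω), Y ω)) = (P.map fun ω => (X ω, Y ω)).map (Prod.map e id) := by
    rw [Measure.map_map (by fun_prop) (by fun_prop)]
    rfl
  have h2 : (P.map fun ω => e (X ω)).prod (gaussianReal 0 1) =
      ((P.map X).prod (gaussianReal 0 1)).map (Prod.map e id) := by
    rw [← Measure.map_prod_map _ _ e.measurable measurable_id, Measure.map_id,
      Measure.map_map e.measurable hX]
    rfl
  unfold CondGaussian at h ⊢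
  rw [h1, h, h2, Measure.map_map (by fun_prop) (by fun_prop),
    Measure.map_map (by fun_prop) (by fun_prop)]
  congr 1
  ext p <;> simp

lemma condGaussian_iff [SFinite P] (hX : Measurable X) (hm : Measurable m) (hv : Measurable v) :
    CondGaussian P X Y m v ↔ P.map (fun ω => (X ω, Y ω)) =
      (P.prod (gaussianReal 0 1)).map fun p => (X p.1, m (X p.1) + √(v (X p.1)) * p.2) := by
  have h2 : (P.map X).prod (gaussianReal 0 1) =
      (P.prod (gaussianReal 0 1)).map (Prod.map X id) := by
    rw [← Measure.map_prod_map _ _ hX measurable_id, Measure.map_id]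
  rw [CondGaussian, h2, Measure.map_map (by fun_prop) (by fun_prop)]
  rfl

lemma measure_eq_sum_fiber {κ : Type*} [Fintype κ] [MeasurableSpace κ] [MeasurableSingletonClass κ]
    (μ : Measure Ω) {c : Ω → κ} (hc : Measurable c) (A : Set Ω) :
    μ A = ∑ k, μ (c ⁻¹' {k} ∩ A) := by
  have h := sum_measure_preimage_singleton (μ := μ.restrict A) (Finset.univ : Finset κ) (f := c)
    fun k _ => hc (measurableSet_singleton k)
  simp only [Finset.coe_univ, Set.preimage_univ, Measure.restrict_apply_univ] at h
  rw [← h]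
  exact Finset.sum_congr rfl fun k _ =>
    Measure.restrict_apply (hc (measurableSet_singleton k))

/-- A variable that coincides on each cell of a finite partition with a variable for which the
conditional law is Gaussian, the cells being determined by either of the two. -/
lemma condGaussian_of_partition [SFinite P] {κ : Type*} [Fintype κ] [MeasurableSpace κ]
    [MeasurableSingletonClass κ] {c : X' → κ} (hc : Measurable c) {Z : κ → Ω → X'}
    {μ ν : κ → X' → ℝ} (hX : Measurable X) (hY : Measurable Y) (hZ : ∀ k, Measurable (Z k))
    (hμ : ∀ k, Measurable (μ k)) (hν : ∀ k, Measurable (ν k))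
    (hm : Measurable fun x => μ (c x) x) (hv : Measurable fun x => ν (c x) x)
    (hcell : ∀ k ω, c (X ω) = k ↔ c (Z k ω) = k) (heq : ∀ ω, X ω = Z (c (X ω)) ω)
    (h : ∀ k, CondGaussian P (Z k) Y (μ k) (ν k)) :
    CondGaussian P X Y (fun x => μ (c x) x) (fun x => ν (c x) x) := by
  rw [condGaussian_iff hX hm hv]
  ext s hs
  have hm' : Measurable fun p : Ω × ℝ => μ (c (X p.1)) (X p.1) := hm.comp (hX.comp measurable_fst)
  have hv' : Measurable fun p : Ω × ℝ => ν (c (X p.1)) (X p.1) := hv.comp (hX.comp measurable_fst)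
  have hout : Measurable fun p : Ω × ℝ =>
      (X p.1, μ (c (X p.1)) (X p.1) + √(ν (c (X p.1)) (X p.1)) * p.2) :=
    (hX.comp measurable_fst).prodMk (hm'.add (hv'.sqrt.mul measurable_snd))
  rw [Measure.map_apply (by fun_prop) hs, Measure.map_apply hout hs,
    measure_eq_sum_fiber P (hc.comp hX), measure_eq_sum_fiber (P.prod (gaussianReal 0 1))
      (hc.comp (hX.comp measurable_fst))]
  refine Finset.sum_congr rfl fun k _ => ?_
  have hk := (condGaussian_iff (hZ k) (hμ k) (hν k)).1 (h k)
  -- Testing the identity for `Z k` on this part of `s` only sees the cell `k`, where `X` and `Z k`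
  -- agree.
  have hs' : MeasurableSet (s ∩ {p | c p.1 = k}) :=
    hs.inter (hc.comp measurable_fst (measurableSet_singleton k))
  have := congrArg (fun M => M (s ∩ {p | c p.1 = k})) hk
  have hμk := hμ k
  have hνk := hν k
  have hZk := hZ k
  rw [Measure.map_apply (by fun_prop) hs', Measure.map_apply (by fun_prop) hs'] at this
  convert this using 2
  · ext ω
    simp only [Set.mem_inter_iff, Set.mem_preimage, Function.comp, Set.mem_singleton_iff,
      Set.mem_ofPred_eq, ← hcell k ω]
    constructor
    · rintro ⟨h1, h2⟩
      have := heq ω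
      rw [h1] at this
      exact ⟨this ▸ h2, h1⟩
    · rintro ⟨h1, h2⟩
      have := heq ω
      rw [h2] at this
      exact ⟨h2, this ▸ h1⟩
  · ext ⟨ω, z⟩
    simp only [Set.mem_inter_iff, Set.mem_preimage, Function.comp, Set.mem_singleton_iff,
      Set.mem_ofPred_eq, ← hcell k ω]
    constructor
    · rintro ⟨h1, h2⟩
      have := heq ω
      rw [h1] at h2 this
      exact ⟨this ▸ h2, h1⟩
    · rintro ⟨h1, h2⟩
      have := heq ω
      rw [h2] at this ⊢
      exact ⟨rfl, this.symm ▸ h1⟩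

end CondGaussian

/-! ### Fixed designs -/

namespace InfoEnv

variable {K : ℕ} (E : InfoEnv K)

instance : IsGaussian E.prior := by unfold prior; infer_instance

instance (q : Fin K → ℕ) : IsProbabilityMeasure (E.sampleLaw q) := by
  unfold sampleLaw; infer_instance

instance (B : ℕ) : IsProbabilityMeasure (E.law B) := by unfold law; infer_instance

lemma measurable_signalMean (k : Fin K) : Measurable fun θ => E.signalMean θ k := by
  unfold signalMean; fun_prop

/-- The errors of a sample, listed along an enumeration, are independent. -/
lemma sampleLaw_map_enum {ι : Type*} [Fintype ι] (q : Fin K → ℕ)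
    (σ : ι ≃ (k : Fin K) × Fin (q k)) :
    (E.sampleLaw q).map (fun ω => (ω.1, fun i => ω.2 (σ i).1 (σ i).2)) =
      E.prior.prod (Measure.pi fun i => gaussianReal 0 (E.noiseVar (σ i).1)) := by
  have h := iIndepFun_uncurry_infinitePi (ι := Fin K) (κ := fun k => Fin (q k))
    (X := fun _ _ (x : ℝ) => x) (fun k _ => gaussianReal 0 (E.noiseVar k))
    fun _ _ => measurable_id
  simp only [Measure.infinitePi_eq_pi] at h
  have h' := (iIndepFun_iff_map_fun_eq_pi_map fun i => by
    exact ((measurable_pi_apply _).comp (measurable_pi_apply _)).aemeasurable).1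
      (h.precomp σ.injective)
  have hm : ∀ i, (Measure.pi fun k => Measure.pi fun _ : Fin (q k) =>
      gaussianReal 0 (E.noiseVar k)).map (fun ω => ω (σ i).1 (σ i).2) =
      gaussianReal 0 (E.noiseVar (σ i).1) := fun i =>
    ((measurePreserving_eval (fun _ : Fin (q (σ i).1) => gaussianReal 0 (E.noiseVar (σ i).1))
      (σ i).2).comp (measurePreserving_eval (fun k => Measure.pi fun _ : Fin (q k) =>
      gaussianReal 0 (E.noiseVar k)) (σ i).1)).map_eq
  simp only [hm] at h'
  rw [← h']
  have := Measure.map_prod_map E.prior (Measure.pi fun k => Measure.pi fun _ : Fin (q k) =>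
      gaussianReal 0 (E.noiseVar k)) (f := id) (g := fun ω i => ω (σ i).1 (σ i).2)
      measurable_id (by fun_prop)
  rw [Measure.map_id] at this
  rw [sampleLaw]
  exact this.symm

/-- Distinct pairs (period, position) read distinct independent coordinates. The right-hand side is
the one of `sampleLaw_map_enum` up to enumeration, so results on samples carry over to the dynamic
model. -/
lemma law_map_design {t B : ℕ} (d : Fin t → Fin B → Fin K) :
    (E.law B).map (fun ω => (ω.1, fun p : Fin t × Fin B => ω.2 p.1 p.2 (d p.1 p.2))) =
      E.prior.prod (Measure.pi fun p => gaussianReal 0 (E.noiseVar (d p.1 p.2))) := by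
  let N : Measure (Fin K → ℝ) := Measure.pi fun k => gaussianReal 0 (E.noiseVar k)
  let M : Measure (ℕ → Fin B → Fin K → ℝ) :=
    Measure.infinitePi fun _ : ℕ => Measure.pi fun _ : Fin B => N
  have h := iIndepFun_uncurry_infinitePi' (ι := ℕ) (κ := Fin B)
    (X := fun _ _ (x : Fin K → ℝ) => x) (fun _ _ => N) fun _ _ => measurable_id
  simp only [Measure.infinitePi_eq_pi] at h
  have hinj : Function.Injective fun p : Fin t × Fin B => ((p.1 : ℕ), p.2) := by
    rintro ⟨a, b⟩ ⟨a', b'⟩ h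
    simp only [Prod.mk.injEq] at h
    exact Prod.ext (Fin.ext h.1) h.2
  have h1 := (h.precomp hinj).comp (fun p x => x (d p.1 p.2)) fun p => by fun_prop
  have h' := (iIndepFun_iff_map_fun_eq_pi_map fun p => by
    exact ((measurable_pi_apply (d p.1 p.2)).comp
      ((measurable_pi_apply p.2).comp (measurable_pi_apply (p.1 : ℕ)))).aemeasurable).1 h1
  have hm : ∀ p : Fin t × Fin B, M.map (fun ω => ω p.1 p.2 (d p.1 p.2)) =
      gaussianReal 0 (E.noiseVar (d p.1 p.2)) := fun p =>
    ((measurePreserving_eval (fun k => gaussianReal 0 (E.noiseVar k)) (d p.1 p.2)).comp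
      ((measurePreserving_eval (fun _ : Fin B => N) p.2).comp
        (measurePreserving_eval_infinitePi (fun _ : ℕ => Measure.pi fun _ : Fin B => N)
          (p.1 : ℕ)))).map_eq
  simp only [Function.comp] at h'
  change M.map _ = Measure.pi fun p : Fin t × Fin B => M.map (fun ω => ω p.1 p.2 (d p.1 p.2)) at h'
  simp only [hm] at h'
  rw [← h']
  have := Measure.map_prod_map E.prior M (f := id)
    (g := fun ω (p : Fin t × Fin B) => ω p.1 p.2 (d p.1 p.2)) measurable_id (by fun_prop)
  rw [Measure.map_id] at this
  exact this.symm

/-- The conditional law of the payoff-relevant state in a sample is Gaussian. -/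
lemma exists_condGaussian_sampleLaw [NeZero K] {ι : Type*} [Fintype ι] (q : Fin K → ℕ)
    (σ : ι ≃ (k : Fin K) × Fin (q k)) :
    ∃ m : (ι → ℝ) → ℝ, Measurable m ∧ CondGaussian (E.sampleLaw q)
      (fun ω i => E.signalMean ω.1 (σ i).1 + ω.2 (σ i).1 (σ i).2) (fun ω => ω.1 0) m
      fun _ => E.posteriorVar q := by
  let X : ι → EuclideanSpace ℝ (Fin K) × ((k : Fin K) → Fin (q k) → ℝ) → ℝ :=
    fun i ω => E.signalMean ω.1 (σ i).1 + ω.2 (σ i).1 (σ i).2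
  have hsm := E.measurable_signalMean
  have hX : Measurable fun ω i => X i ω := by
    refine measurable_pi_lambda _ fun i => ?_
    have := hsm (σ i).1
    fun_prop
  have hgauss : HasGaussianLaw (fun ω => (fun i => X i ω, ω.1 0)) (E.sampleLaw q) := by
    have h1 : HasGaussianLaw (fun ω : EuclideanSpace ℝ (Fin K) × ((k : Fin K) → Fin (q k) → ℝ) =>
        (ω.1, fun i => ω.2 (σ i).1 (σ i).2)) (E.sampleLaw q) := by
      refine ⟨?_⟩
      rw [E.sampleLaw_map_enum q σ]
      have h2 : HasGaussianLaw (fun x : ι → ℝ => fun i => x i)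
          (Measure.pi fun i => gaussianReal 0 (E.noiseVar (σ i).1)) := by
        refine iIndepFun.hasGaussianLaw (X := fun i (x : ι → ℝ) => x i) (fun i => ⟨?_⟩)
          (iIndepFun_pi (X := fun _ => id) fun i => aemeasurable_id)
        rw [(measurePreserving_eval _ i).map_eq]
        infer_instance
      have h3 := h2.isGaussian_map
      rw [show (fun x : ι → ℝ => fun i => x i) = id from rfl, Measure.map_id] at h3
      infer_instance
    let s : Fin K → EuclideanSpace ℝ (Fin K) →L[ℝ] ℝ := fun k =>
      ∑ j, E.coeff k j • (EuclideanSpace.proj j : EuclideanSpace ℝ (Fin K) →L[ℝ] ℝ)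
    let L : EuclideanSpace ℝ (Fin K) × (ι → ℝ) →L[ℝ] (ι → ℝ) × ℝ :=
      (ContinuousLinearMap.pi fun i => (s (σ i).1).comp (ContinuousLinearMap.fst ℝ _ _) +
        (ContinuousLinearMap.proj (R := ℝ) (φ := fun _ : ι => ℝ) i).comp
          (ContinuousLinearMap.snd ℝ _ _)).prod
      ((EuclideanSpace.proj 0 : EuclideanSpace ℝ (Fin K) →L[ℝ] ℝ).comp
        (ContinuousLinearMap.fst ℝ _ _))
    have e : (fun ω => (fun i => X i ω, ω.1 0)) =
        fun ω : EuclideanSpace ℝ (Fin K) × ((k : Fin K) → Fin (q k) → ℝ) =>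
          L (ω.1, fun i => ω.2 (σ i).1 (σ i).2) := by
      ext <;> simp [L, X, s, signalMean]
    rw [e]
    exact h1.map_fun L
  obtain ⟨m, v, hm, hind, hR⟩ := hgauss.exists_indepFun_residual
  have hY : Measurable fun ω : EuclideanSpace ℝ (Fin K) × ((k : Fin K) → Fin (q k) → ℝ) =>
      ω.1 0 := by fun_prop
  -- `e` and `e'` translate between the listing along `σ` and the listing by source, so the residual
  -- is also independent of `sampleObs`.
  have hpost : E.posteriorVar q = v := by
    let e : ((k : Fin K) → Fin (q k) → ℝ) → ι → ℝ := fun x i => x (σ i).1 (σ i).2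
    let e' : (ι → ℝ) → (k : Fin K) → Fin (q k) → ℝ := fun x k j => x (σ.symm ⟨k, j⟩)
    have he : ∀ ω, (fun i => X i ω) = e (E.sampleObs q ω) := fun ω => rfl
    have he' : E.sampleObs q = e' ∘ fun ω i => X i ω := by
      ext ω k j
      change _ = (fun p : (k : Fin K) × Fin (q k) => E.signalMean ω.1 p.1 + ω.2 p.1 p.2)
        (σ (σ.symm ⟨k, j⟩))
      rw [Equiv.apply_symm_apply]
      rfl
    have hobs : Measurable (E.sampleObs q) := by
      rw [he']
      exact (by fun_prop : Measurable e').comp hX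
    refine integral_condVar_of_indepFun_residual (m := m ∘ e) hobs hY
      (hm.comp (by fun_prop)) hgauss.snd.integrable ?_ hR
    have h1 := hind.comp (φ := e') (ψ := id) (by fun_prop) measurable_id
    rw [← he'] at h1
    exact h1
  refine ⟨m, hm, ?_⟩
  rw [hpost]
  exact condGaussian_of_indepFun_residual hX hY hm hind hR

/-- The observations of a fixed design: `d s b` is the source of the `b`-th observation of
period `s`. -/
def designObs {t B : ℕ} (d : Fin t → Fin B → Fin K)
    (ω : EuclideanSpace ℝ (Fin K) × (ℕ → Fin B → Fin K → ℝ)) : Fin t → Fin B → ℝ :=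
  fun s b => E.signalMean ω.1 (d s b) + ω.2 s b (d s b)

lemma measurable_designObs {t B : ℕ} (d : Fin t → Fin B → Fin K) : Measurable (E.designObs d) := by
  refine measurable_pi_lambda _ fun s => measurable_pi_lambda _ fun b => ?_
  have := E.measurable_signalMean (d s b)
  unfold designObs
  fun_prop

/-- A fixed design is a sample in another order: the fibre of `d` over source `k` has as many
elements as `k` has observations, and `σ` enumerates the fibres. -/
lemma exists_condGaussian_designObs [NeZero K] {t B : ℕ} (d : Fin t → Fin B → Fin K) :
    ∃ m : (Fin t → Fin B → ℝ) → ℝ, Measurable m ∧ CondGaussian (E.law B)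
      (E.designObs d) (fun ω => ω.1 0) m
      fun _ => E.posteriorVar fun k => ∑ s, blockCount (d s) k := by
  let d' : Fin t × Fin B → Fin K := fun p => d p.1 p.2
  let q : Fin K → ℕ := fun k => ∑ s, blockCount (d s) k
  have hcard : ∀ k, Fintype.card {p // d' p = k} = q k := by
    intro k
    rw [Fintype.card_subtype, Finset.card_filter, Fintype.sum_prod_type]
    exact Finset.sum_congr rfl fun s _ => by rw [blockCount, Finset.card_filter]
  let σ : Fin t × Fin B ≃ (k : Fin K) × Fin (q k) :=
    (Equiv.sigmaFiberEquiv d').symm.trans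
      (Equiv.sigmaCongrRight fun k => Fintype.equivFinOfCardEq (hcard k))
  have hσ : ∀ p, (σ p).1 = d p.1 p.2 := fun p => rfl
  obtain ⟨m, hm, h⟩ := E.exists_condGaussian_sampleLaw q σ
  have hsm := E.measurable_signalMean
  let T : EuclideanSpace ℝ (Fin K) × (Fin t × Fin B → ℝ) → (Fin t × Fin B → ℝ) × ℝ :=
    fun x => (fun p => E.signalMean x.1 (d p.1 p.2) + x.2 p, x.1 0)
  have hT : Measurable T := by
    refine Measurable.prodMk (measurable_pi_lambda _ fun p => ?_) (by fun_prop)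
    have := hsm (d p.1 p.2)
    fun_prop
  have h' : CondGaussian (E.law B) (fun ω (p : Fin t × Fin B) => E.designObs d ω p.1 p.2)
      (fun ω => ω.1 0) m fun _ => E.posteriorVar q := by
    refine h.of_map_eq ?_ (by fun_prop) ?_ (by fun_prop) ?_
    · refine measurable_pi_lambda _ fun i => ?_
      have := hsm (σ i).1
      fun_prop
    · have := E.measurable_designObs d
      fun_prop
    · have h1 := congrArg (Measure.map T) (E.law_map_design d)
      have h2 := congrArg (Measure.map T) (E.sampleLaw_map_enum q σ)
      rw [Measure.map_map hT (by fun_prop)] at h1 h2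
      exact h1.trans h2.symm
  exact ⟨_, hm.comp (MeasurableEquiv.curry (Fin t) (Fin B) ℝ).symm.measurable,
    h'.map_equiv (MeasurableEquiv.curry (Fin t) (Fin B) ℝ)
      (by have := E.measurable_designObs d; fun_prop) (by fun_prop) hm measurable_const⟩

end InfoEnv

/-! ### Adaptive histories -/

/-- The sources prescribed by a strategy along a history. -/
def AcqStrategy.path {K B : ℕ} (S : AcqStrategy K B) {t : ℕ} (h : Fin t → Fin B → ℝ) :
    Fin t → Fin B → Fin K :=
  fun s => S.choose s fun i => h (Fin.castLE s.isLt.le i)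

lemma AcqStrategy.measurable_path {K B : ℕ} (S : AcqStrategy K B) {t : ℕ} :
    Measurable (S.path : (Fin t → Fin B → ℝ) → Fin t → Fin B → Fin K) :=
  measurable_pi_lambda _ fun s => (S.measurable_choose s).comp (by fun_prop)

namespace InfoEnv

variable {K : ℕ} (E : InfoEnv K) {B : ℕ} (S : AcqStrategy K B)

lemma history_castSucc (ω) (t : ℕ) (s : Fin t) :
    E.history S ω (t + 1) s.castSucc = E.history S ω t s := by
  simp [history]

lemma history_castLE (ω) {t n : ℕ} (h : n ≤ t) (i : Fin n) :
    E.history S ω t (Fin.castLE h i) = E.history S ω n i := by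
  induction t, h using Nat.le_induction with
  | base => rfl
  | succ t h ih => rw [← ih, ← E.history_castSucc S ω t]; rfl

/-- The history solves a fixed-point equation: it is what the design prescribed along it reveals. -/
lemma history_eq_designObs (ω) (t : ℕ) :
    E.history S ω t = E.designObs (S.path (E.history S ω t)) ω := by
  ext s b
  have h := E.history_castLE S ω (Nat.succ_le_of_lt s.isLt) (Fin.last s)
  have e : Fin.castLE (Nat.succ_le_of_lt s.isLt) (Fin.last s) = s := by ext; simp
  rw [e] at h
  have e2 : S.path (E.history S ω t) s = S.choose s (E.history S ω s) := by
    unfold AcqStrategy.path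
    congr 1
    ext i : 1
    exact E.history_castLE S ω s.isLt.le i
  rw [h, designObs, e2]
  simp [history]

/-- The fixed point is unique, by induction on the period, because each choice depends on strictly
earlier realizations only. -/
lemma eq_history_of_eq_designObs (ω) (t : ℕ) (x : Fin t → Fin B → ℝ)
    (hx : x = E.designObs (S.path x) ω) : x = E.history S ω t := by
  have key : ∀ n (hn : n ≤ t), (fun i => x (Fin.castLE hn i)) = E.history S ω n := by
    intro n
    induction n with
    | zero => intro _; ext i; exact i.elim0
    | succ n ih =>
      intro hn
      ext i : 1
      refine Fin.lastCases ?_ (fun i => ?_) i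
      · have e : Fin.castLE hn (Fin.last n) = ⟨n, hn⟩ := rfl
        rw [e, hx]
        ext b
        have e2 : S.path x ⟨n, hn⟩ = S.choose n (E.history S ω n) := by
          rw [← ih (by omega)]
          rfl
        rw [designObs, e2]
        simp [history]
      · rw [history_castSucc, ← ih (by omega)]
        rfl
  exact key t le_rfl

lemma measurable_history (t : ℕ) : Measurable fun ω => E.history S ω t := by
  induction t with
  | zero => exact measurable_of_subsingleton_codomain _
  | succ t ih =>
    refine measurable_pi_lambda _ fun s => ?_
    refine Fin.lastCases ?_ (fun s => ?_) s
    · refine measurable_pi_lambda _ fun b => ?_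
      have h : Measurable fun p : Fin K × (EuclideanSpace ℝ (Fin K) × (ℕ → Fin B → Fin K → ℝ)) =>
          E.signalMean p.2.1 p.1 + p.2.2 t b p.1 := by
        refine measurable_from_prod_countable_right fun k => ?_
        have h1 : Measurable fun y : EuclideanSpace ℝ (Fin K) × (ℕ → Fin B → Fin K → ℝ) =>
            E.signalMean y.1 k := (E.measurable_signalMean k).comp measurable_fst
        exact h1.add (by simp only; fun_prop)
      have hc : Measurable fun ω => S.choose t (E.history S ω t) b :=
        (measurable_pi_apply b).comp ((S.measurable_choose t).comp ih)
      simpa [history] using! h.comp (hc.prodMk measurable_id)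
    · simp only [history_castSucc]
      exact (measurable_pi_apply s).comp ih

/-- Adaptive choice does not disturb the Gaussian posterior. There are finitely many designs `d`;
where the path of the history is `d`, the history equals the observations of the fixed design `d`,
and by the fixed-point property this event can be read off from either of them. -/
lemma exists_condGaussian_history [NeZero K] (t : ℕ) :
    ∃ m : (Fin t → Fin B → ℝ) → ℝ, Measurable m ∧
      Measurable (fun h => E.posteriorVar (S.division t h)) ∧
      CondGaussian (E.law B) (fun ω => E.history S ω t) (fun ω => ω.1 0) m
        fun h => E.posteriorVar (S.division t h) := by
  choose μ hμ hcond using fun d : Fin t → Fin B → Fin K => E.exists_condGaussian_designObs d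
  have hm : Measurable fun x => μ (S.path x) x :=
    (measurable_from_prod_countable_right (f := fun p : (Fin t → Fin B → Fin K) × _ => μ p.1 p.2)
      hμ).comp (S.measurable_path.prodMk measurable_id)
  have hv : Measurable fun x : Fin t → Fin B → ℝ =>
      E.posteriorVar fun k => ∑ s, blockCount (S.path x s) k :=
    (measurable_of_countable (f := fun d : Fin t → Fin B → Fin K =>
      E.posteriorVar fun k => ∑ s, blockCount (d s) k)).comp S.measurable_path
  refine ⟨fun x => μ (S.path x) x, hm, hv, ?_⟩
  refine condGaussian_of_partition S.measurable_path (E.measurable_history S t) (by fun_prop)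
    E.measurable_designObs hμ (fun _ => measurable_const) hm hv (fun d ω => ⟨?_, ?_⟩)
    (fun ω => E.history_eq_designObs S ω t) hcond
  · rintro rfl
    rw [← E.history_eq_designObs S ω t]
  · intro h
    have := E.eq_history_of_eq_designObs S ω t (E.designObs d ω) (by rw [h])
    rw [← this, h]

end InfoEnv

/-! ### Simulating a less informative experiment -/

lemma MeasureTheory.Measure.map_prod_left {α β γ : Type*} [MeasurableSpace α] [MeasurableSpace β]
    [MeasurableSpace γ] (μ : Measure α) (ν : Measure β) [SFinite μ] [SFinite ν] {f : α → γ}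
    (hf : Measurable f) : (μ.map f).prod ν = (μ.prod ν).map fun p => (f p.1, p.2) := by
  have := Measure.map_prod_map μ ν hf measurable_id
  rwa [Measure.map_id] at this

/-- A measure on a product with `ℝ` is determined by its convolution, in the real variable, with a
Gaussian. -/
lemma eq_of_map_add_gaussian_eq {X : Type*} [MeasurableSpace X] (μ ν : Measure (X × ℝ))
    [IsFiniteMeasure μ] [IsFiniteMeasure ν] (s : ℝ)
    (h : (μ.prod (gaussianReal 0 1)).map (fun p => (p.1.1, p.1.2 + s * p.2)) =
      (ν.prod (gaussianReal 0 1)).map (fun p => (p.1.1, p.1.2 + s * p.2))) : μ = ν := by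
  have hs : Measurable fun p : (X × ℝ) × ℝ => (p.1.1, p.1.2 + s * p.2) := by fun_prop
  let G : Measure ℝ := (gaussianReal 0 1).map (s * ·)
  obtain ⟨μG, vG, hG⟩ : ∃ a b, G = gaussianReal a b := ⟨_, _, gaussianReal_map_const_mul s⟩
  have hconv : ∀ (μ : Measure (X × ℝ)) [IsFiniteMeasure μ] (A : Set X), MeasurableSet A →
      ∀ C, MeasurableSet C → (((μ.restrict (A ×ˢ Set.univ)).map Prod.snd) ∗ G) C =
        (μ.prod (gaussianReal 0 1)).map (fun p => (p.1.1, p.1.2 + s * p.2)) (A ×ˢ C) := by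
    intro μ _ A hA C hC
    have e : (((μ.restrict (A ×ˢ Set.univ)).map Prod.snd) ∗ G) =
        ((μ.prod (gaussianReal 0 1)).restrict ((A ×ˢ Set.univ) ×ˢ Set.univ)).map
          fun p => p.1.2 + s * p.2 := by
      rw [Measure.conv, Measure.map_prod_map _ _ measurable_snd (by fun_prop),
        Measure.map_map (by fun_prop) (by fun_prop), ← Measure.prod_restrict,
        Measure.restrict_univ]
      rfl
    rw [e, Measure.map_apply (by fun_prop) hC, Measure.restrict_apply
      ((by fun_prop : Measurable fun p : (X × ℝ) × ℝ => p.1.2 + s * p.2) hC),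
      Measure.map_apply hs (hA.prod hC)]
    congr 1
    ext p
    simp [and_comm]
  refine Measure.ext_prod_iff.2 fun {A C} hA hC => ?_
  have hcA : ((μ.restrict (A ×ˢ Set.univ)).map Prod.snd) ∗ G =
      ((ν.restrict (A ×ˢ Set.univ)).map Prod.snd) ∗ G := by
    ext C hC
    rw [hconv μ A hA C hC, hconv ν A hA C hC, h]
  have hGp : IsProbabilityMeasure G := by rw [hG]; infer_instance
  have hA' : (μ.restrict (A ×ˢ Set.univ)).map Prod.snd =
      (ν.restrict (A ×ˢ Set.univ)).map Prod.snd := by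
    -- Convolution with `G` multiplies the characteristic function by that of a Gaussian, which
    -- vanishes nowhere and cancels.
    refine Measure.ext_of_charFun ?_
    ext x
    have := congrArg (fun M => charFun M x) hcA
    simp only [charFun_conv] at this
    refine mul_right_cancel₀ ?_ this
    rw [hG, charFun_gaussianReal]
    exact Complex.exp_ne_zero _
  have := congrArg (fun M => M C) hA'
  simp only [Measure.map_apply measurable_snd hC, Measure.restrict_apply (measurable_snd hC)]
    at this
  convert this using 2 <;> · ext p; simp [and_comm]

lemma map_add_gaussian (a b : ℝ) :
    ((gaussianReal 0 1).prod (gaussianReal 0 1)).map (fun p => a * p.1 + b * p.2) =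
      (gaussianReal 0 1).map fun z => √(a ^ 2 + b ^ 2) * z := by
  have h : ((gaussianReal 0 1).prod (gaussianReal 0 1)).map (fun p => a * p.1 + b * p.2) =
      ((gaussianReal 0 1).map (a * ·)) ∗ ((gaussianReal 0 1).map (b * ·)) := by
    rw [Measure.conv, Measure.map_prod_map _ _ (by fun_prop) (by fun_prop),
      Measure.map_map (by fun_prop) (by fun_prop)]
    rfl
  rw [h, gaussianReal_map_const_mul, gaussianReal_map_const_mul, gaussianReal_conv_gaussianReal,
    gaussianReal_map_const_mul]
  congr 1
  · simp
  · ext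
    simp [Real.sq_sqrt (add_nonneg (sq_nonneg a) (sq_nonneg b))]

/-- For each fixed `x`, independent noises of variances `v x - w` and `w` add up to one of variance
`v x`. -/
lemma map_add_gaussian_gaussian {X : Type*} [MeasurableSpace X] (μ : Measure X) [SFinite μ]
    {m v : X → ℝ} (hm : Measurable m) (hv : Measurable v) {w : ℝ} (hw : 0 ≤ w)
    (hwv : ∀ x, w ≤ v x) :
    ((μ.prod (gaussianReal 0 1)).prod (gaussianReal 0 1)).map
        (fun p => (p.1.1, m p.1.1 + √(v p.1.1 - w) * p.1.2 + √w * p.2)) =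
      (μ.prod (gaussianReal 0 1)).map fun p => (p.1, m p.1 + √(v p.1) * p.2) := by
  have h1 : (μ.prod (gaussianReal 0 1)).prod (gaussianReal 0 1) =
      (μ.prod ((gaussianReal 0 1).prod (gaussianReal 0 1))).map
        (MeasurableEquiv.prodAssoc (α := X) (β := ℝ) (γ := ℝ)).symm :=
    (measurePreserving_prodAssoc μ (gaussianReal 0 1) (gaussianReal 0 1)).symm.map_eq.symm
  rw [h1, Measure.map_map (by fun_prop) (by fun_prop)]
  ext s hs
  have hf : Measurable ((fun p : (X × ℝ) × ℝ =>
      (p.1.1, m p.1.1 + √(v p.1.1 - w) * p.1.2 + √w * p.2)) ∘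
      (MeasurableEquiv.prodAssoc (α := X) (β := ℝ) (γ := ℝ)).symm) := by fun_prop
  have hg : Measurable fun p : X × ℝ => (p.1, m p.1 + √(v p.1) * p.2) := by fun_prop
  rw [Measure.map_apply hf hs, Measure.map_apply hg hs, Measure.prod_apply (hf hs),
    Measure.prod_apply (hg hs)]
  refine lintegral_congr fun x => ?_
  let C : Set ℝ := {y | (x, m x + y) ∈ s}
  have hC : MeasurableSet C := (by fun_prop : Measurable fun y => (x, m x + y)) hs
  have h := congrArg (fun M => M C) (map_add_gaussian √(v x - w) √w)
  simp only [Measure.map_apply (by fun_prop : Measurable fun p : ℝ × ℝ =>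
    √(v x - w) * p.1 + √w * p.2) hC,
    Measure.map_apply (by fun_prop : Measurable fun z : ℝ => √(v x) * z) hC,
    Real.sq_sqrt (sub_nonneg.2 (hwv x)), Real.sq_sqrt hw, sub_add_cancel] at h
  convert h using 2
  · ext p
    simp [C, MeasurableEquiv.prodAssoc, add_assoc]
  · rfl

section Simulation

variable {Ω : Type*} [MeasurableSpace Ω] {P : Measure Ω} [IsProbabilityMeasure P]

/-- If the conditional law of `Y` given `X` is Gaussian with constant variance, it is not changed
by independent randomization, and depends on the mean only. -/
lemma CondGaussian.randomize {X' R Z : Type*} [MeasurableSpace X'] [MeasurableSpace R]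
    [MeasurableSpace Z] {X : Ω → X'} {Y : Ω → ℝ} {m : X' → ℝ} {w : ℝ}
    (h : CondGaussian P X Y m fun _ => w) (hX : Measurable X) (hY : Measurable Y)
    (hm : Measurable m) (ρ : Measure R) [IsProbabilityMeasure ρ] {g : X' × R → Z}
    (hg : Measurable g) :
    CondGaussian (P.prod ρ) (fun p => (g (X p.1, p.2), m (X p.1))) (fun p => Y p.1)
      Prod.snd fun _ => w := by
  rw [condGaussian_iff (by fun_prop) measurable_snd measurable_const]
  rw [condGaussian_iff hX hm measurable_const] at h
  have h1 : (P.prod ρ).map (fun p => ((g (X p.1, p.2), m (X p.1)), Y p.1)) =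
      ((P.map fun ω => (X ω, Y ω)).prod ρ).map
        fun p => ((g (p.1.1, p.2), m p.1.1), p.1.2) := by
    rw [Measure.map_prod_left _ _ (by fun_prop), Measure.map_map (by fun_prop) (by fun_prop)]
    rfl
  have h2 : (P.prod ρ).prod (gaussianReal 0 1) =
      ((P.prod (gaussianReal 0 1)).prod ρ).map fun p => ((p.1.1, p.2), p.1.2) := by
    have e1 := (measurePreserving_prodAssoc P ρ (gaussianReal 0 1)).symm
    have e2 := (MeasurePreserving.id P).prod
      (Measure.measurePreserving_swap (μ := gaussianReal 0 1) (ν := ρ))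
    have e3 := measurePreserving_prodAssoc P (gaussianReal 0 1) ρ
    exact ((e1.comp e2).comp e3).map_eq.symm
  rw [h1, h, h2, Measure.map_prod_left _ _ (by fun_prop),
    Measure.map_map (by fun_prop) (by fun_prop), Measure.map_map (by fun_prop) (by fun_prop)]
  rfl

/-- One step of the simulation: a new signal `e`, following `H`, can be drawn with the right law
from `H` and the posterior mean of a more informative experiment. -/
lemma exists_simulation_step {X α : Type*} [MeasurableSpace X] [MeasurableSpace α]
    [StandardBorelSpace α] [Nonempty α] {H : Ω → X} {e : Ω → α} {Y : Ω → ℝ} (hH : Measurable H)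
    (he : Measurable e) (hY : Measurable Y) {m v : X × α → ℝ} (hm : Measurable m)
    (hv : Measurable v) (h : CondGaussian P (fun ω => (H ω, e ω)) Y m v) {w : ℝ} (hw : 0 ≤ w)
    (hwv : ∀ x, w ≤ v x) :
    ∃ f : X × ℝ → unitInterval → α, Measurable (Function.uncurry f) ∧
      ∀ {Ω₂ : Type _} [MeasurableSpace Ω₂] (Q : Measure Ω₂) [IsProbabilityMeasure Q]
        (Ĥ : Ω₂ → X) (N Y₂ : Ω₂ → ℝ), Measurable Ĥ → Measurable N → Measurable Y₂ →
        Q.map (fun ω => (Ĥ ω, Y₂ ω)) = P.map (fun ω => (H ω, Y ω)) →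
        CondGaussian Q (fun ω => (Ĥ ω, N ω)) Y₂ Prod.snd (fun _ => w) →
        (Q.prod volume).map (fun p => ((Ĥ p.1, f (Ĥ p.1, N p.1) p.2), Y₂ p.1)) =
          P.map (fun ω => ((H ω, e ω), Y ω)) := by
  -- A stand-in for the posterior mean of the better experiment: the rival mean, blurred so that
  -- only variance `w` is left to explain.
  let N' : Ω × ℝ → ℝ := fun p =>
    m (H p.1, e p.1) + √(v (H p.1, e p.1) - w) * p.2
  let γ := gaussianReal 0 1
  have hN' : Measurable N' := by fun_prop
  have hHN : Measurable fun p : Ω × ℝ => (H p.1, N' p) := by fun_prop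
  -- The new signal is to be drawn from its conditional law given the past and `N'`; `f` realizes
  -- this kernel from one uniform variable.
  let κ := condDistrib (fun p : Ω × ℝ => e p.1) (fun p => (H p.1, N' p)) (P.prod γ)
  obtain ⟨f, hf, hfκ⟩ := κ.exists_measurable_map_eq_unitInterval
  -- adding noise to `N'` recovers the joint law with `Y`
  have hadd : ((P.prod γ).prod γ).map (fun p => ((H p.1.1, e p.1.1), N' p.1 + √w * p.2)) =
      P.map fun ω => ((H ω, e ω), Y ω) := by
    have h1 := map_add_gaussian_gaussian (P.map fun ω => (H ω, e ω)) hm hv hw hwv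
    rw [Measure.map_prod_left _ _ (by fun_prop), Measure.map_prod_left _ _ (by fun_prop),
      Measure.map_map (by fun_prop) (by fun_prop), Measure.map_map (by fun_prop) (by fun_prop)]
      at h1
    rw [(condGaussian_iff (by fun_prop) hm hv).1 h]
    exact h1
  refine ⟨f, hf, ?_⟩
  intro Ω₂ _ Q _ Ĥ N Y₂ hĤ hN hY₂ hlaw hcond
  -- Adding independent noise of variance `w` to the second entry gives the law of the past with the
  -- state on both sides, so deconvolution applies.
  have hlawN : Q.map (fun ω => (Ĥ ω, N ω)) = (P.prod γ).map fun p => (H p.1, N' p) := by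
    have := Measure.isProbabilityMeasure_map (μ := Q)
      (by fun_prop : Measurable fun ω => (Ĥ ω, N ω)).aemeasurable
    have := Measure.isProbabilityMeasure_map (μ := P.prod γ) hHN.aemeasurable
    refine eq_of_map_add_gaussian_eq _ _ √w ?_
    have h1 := congrArg (Measure.map fun p : (X × ℝ) × ℝ => (p.1.1, p.2)) hcond
    rw [Measure.map_map (by fun_prop) (by fun_prop),
      Measure.map_map (by fun_prop) (by fun_prop)] at h1
    have h2 := congrArg (Measure.map fun p : (X × α) × ℝ => (p.1.1, p.2)) hadd
    rw [Measure.map_map (by fun_prop) (by fun_prop),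
      Measure.map_map (by fun_prop) (by fun_prop)] at h2
    rw [Measure.map_prod_left (P.prod γ) _ hHN, Measure.map_map (by fun_prop) (by fun_prop)]
    exact h1.symm.trans (hlaw.trans h2.symm)
  have hdraw : (Q.prod volume).map (fun p => ((Ĥ p.1, N p.1), f (Ĥ p.1, N p.1) p.2)) =
      (P.prod γ).map fun p => ((H p.1, N' p), e p.1) := by
    have h1 : ((P.prod γ).map fun p => (H p.1, N' p)) ⊗ₘ κ =
        (P.prod γ).map fun p => ((H p.1, N' p), e p.1) :=
      compProd_map_condDistrib (by fun_prop)
    rw [← h1, ← hlawN]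
    have h2 : (Q.prod volume).map (fun p => ((Ĥ p.1, N p.1), f (Ĥ p.1, N p.1) p.2)) =
        ((Q.map fun ω => (Ĥ ω, N ω)).prod volume).map fun p => (p.1, f p.1 p.2) := by
      rw [Measure.map_prod_left _ _ (by fun_prop), Measure.map_map (by fun_prop) (by fun_prop)]
      rfl
    have hfm : Measurable fun p : (X × ℝ) × unitInterval => (p.1, f p.1 p.2) :=
      measurable_fst.prodMk hf
    have := Measure.isProbabilityMeasure_map (μ := Q)
      (by fun_prop : Measurable fun ω => (Ĥ ω, N ω)).aemeasurable
    rw [h2]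
    ext s hs
    rw [Measure.map_apply hfm hs, Measure.prod_apply (hfm hs), Measure.compProd_apply hs]
    refine lintegral_congr fun x => ?_
    rw [← hfκ x, Measure.map_apply hf.of_uncurry_left (measurable_prodMk_left hs)]
    rfl
  -- The uniform variable is independent, so given `Ĥ`, `N` and the draw, the state is still `N`
  -- plus noise of variance `w`.
  have hcond' := hcond.randomize (Z := (X × ℝ) × unitInterval) (by fun_prop) hY₂ measurable_snd
    (volume : Measure unitInterval) (g := fun p => (p.1, p.2)) (by fun_prop)
  rw [condGaussian_iff (by fun_prop) measurable_snd measurable_const] at hcond'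
  have hfm : Measurable fun p : (X × ℝ) × unitInterval => f p.1 p.2 := hf
  have h3 := congrArg (Measure.map fun p : (((X × ℝ) × unitInterval) × ℝ) × ℝ =>
    ((p.1.1.1.1, f p.1.1.1 p.1.1.2), p.2)) hcond'
  rw [Measure.map_map (by fun_prop) (by fun_prop),
    Measure.map_map (by fun_prop) (by fun_prop)] at h3
  have h4 := congrArg (fun M => (M.prod γ).map fun p : ((X × ℝ) × α) × ℝ =>
    ((p.1.1.1, p.1.2), p.1.1.2 + √w * p.2)) hdraw
  beta_reduce at h4
  rw [Measure.map_prod_left _ _ (by fun_prop), Measure.map_prod_left _ _ (by fun_prop),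
    Measure.map_map (by fun_prop) (by fun_prop),
    Measure.map_map (by fun_prop) (by fun_prop)] at h4
  exact h3.trans (h4.trans hadd)

end Simulation

/-! ### Sequential simulation and the law of whole histories -/

lemma measurable_fin_init {α : Type*} [MeasurableSpace α] {t : ℕ} :
    Measurable fun x : Fin (t + 1) → α => (Fin.init x : Fin t → α) :=
  measurable_pi_lambda _ fun _ => measurable_pi_apply _

lemma measurable_fin_snoc {α : Type*} [MeasurableSpace α] {t : ℕ} :
    Measurable fun p : (Fin t → α) × α => (Fin.snoc p.1 p.2 : Fin (t + 1) → α) := by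
  refine measurable_pi_lambda _ fun i => ?_
  refine Fin.lastCases ?_ (fun i => ?_) i
  · simpa using measurable_snd
  · simpa using! (measurable_pi_apply i).comp measurable_fst

/-- Splitting off the last entry of a finite sequence. -/
def MeasurableEquiv.finInitLast (α : Type*) [MeasurableSpace α] (t : ℕ) :
    (Fin (t + 1) → α) ≃ᵐ (Fin t → α) × α where
  toFun x := (Fin.init x, x (Fin.last t))
  invFun p := Fin.snoc p.1 p.2
  left_inv x := Fin.snoc_init_self x
  right_inv p := by ext <;> simp
  measurable_toFun := measurable_fin_init.prodMk (measurable_pi_apply _)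
  measurable_invFun := measurable_fin_snoc

lemma measurePreserving_finInitLast {α : Type*} [MeasurableSpace α] (μ : Measure α)
    [SigmaFinite μ] (t : ℕ) :
    MeasurePreserving (MeasurableEquiv.finInitLast α t) (Measure.pi fun _ => μ)
      ((Measure.pi fun _ => μ).prod μ) := by
  have h := Measure.measurePreserving_swap.comp
    (measurePreserving_piFinSuccAbove (fun _ : Fin (t + 1) => μ) (Fin.last t))
  convert h using 1
  ext x
  · simp [MeasurableEquiv.finInitLast, MeasurableEquiv.piFinSuccAbove, Fin.init]
  · simp [MeasurableEquiv.finInitLast, MeasurableEquiv.piFinSuccAbove]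

lemma apply_eq_last_of_init_eq {Ω α : Type*} {h : (t : ℕ) → Ω → Fin t → α}
    (hinit : ∀ t ω, Fin.init (h (t + 1) ω) = h t ω) (ω : Ω) (t : ℕ) (i : Fin t) :
    h t ω i = h (i + 1) ω (Fin.last i) := by
  induction t with
  | zero => exact i.elim0
  | succ t ih =>
    refine Fin.lastCases ?_ (fun i => ?_) i
    · rfl
    · have : h (t + 1) ω i.castSucc = Fin.init (h (t + 1) ω) i := rfl
      rw [this, hinit, ih]
      rfl

section Simulation

variable {Ω : Type*} [MeasurableSpace Ω] {P : Measure Ω} [IsProbabilityMeasure P]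

/-- If in every period the posterior variance of `Y` under the signals `h` is at most the one under
the signals `h'`, then `h'` can be simulated, period by period, from `h` and independent uniform
variables. -/
lemma exists_simulation {α : Type*} [MeasurableSpace α] [StandardBorelSpace α] [Nonempty α]
    {Y : Ω → ℝ} (hY : Measurable Y) {h h' : (t : ℕ) → Ω → Fin t → α}
    (hh : ∀ t, Measurable (h t)) (hh' : ∀ t, Measurable (h' t))
    (hinit : ∀ t ω, Fin.init (h (t + 1) ω) = h t ω)
    (hinit' : ∀ t ω, Fin.init (h' (t + 1) ω) = h' t ω)
    {m m' v' : (t : ℕ) → (Fin t → α) → ℝ} {w : ℕ → ℝ} (hm : ∀ t, Measurable (m t))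
    (hm' : ∀ t, Measurable (m' t)) (hv' : ∀ t, Measurable (v' t))
    (hcond : ∀ t, CondGaussian P (h t) Y (m t) fun _ => w t)
    (hcond' : ∀ t, CondGaussian P (h' t) Y (m' t) (v' t))
    (hw : ∀ t, 0 ≤ w t) (hwv : ∀ t x, w t ≤ v' t x) :
    ∃ Φ : (t : ℕ) → (Fin t → unitInterval) → (Fin t → α) → Fin t → α,
      (∀ t, Measurable (Function.uncurry (Φ t))) ∧
      (∀ t r x, Fin.init (Φ (t + 1) r x) = Φ t (Fin.init r) (Fin.init x)) ∧
      ∀ t, (P.prod (Measure.pi fun _ => volume)).map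
        (fun p => (Φ t p.2 (h t p.1), Y p.1)) = P.map fun ω => (h' t ω, Y ω) := by
  have hstep : ∀ t, _ := fun t =>
    exists_simulation_step (H := h' t) (e := fun ω => h' (t + 1) ω (Fin.last t)) (hh' t)
      ((measurable_pi_apply _).comp (hh' (t + 1))) hY
      ((hm' (t + 1)).comp (MeasurableEquiv.finInitLast α t).symm.measurable)
      ((hv' (t + 1)).comp (MeasurableEquiv.finInitLast α t).symm.measurable)
      (by
        have := (hcond' (t + 1)).map_equiv (MeasurableEquiv.finInitLast α t) (hh' _) hY (hm' _)
          (hv' _)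
        have e : (fun ω => MeasurableEquiv.finInitLast α t (h' (t + 1) ω)) =
            fun ω => (h' t ω, h' (t + 1) ω (Fin.last t)) := by
          ext ω : 1
          exact Prod.ext (hinit' t ω) rfl
        rw [e] at this
        exact this) (hw (t + 1)) fun x => hwv (t + 1) _
  choose f hf hsim using hstep
  -- Each period appends one draw to the unchanged simulated past, using the posterior mean that
  -- includes the current real signal and a fresh uniform variable.
  let Φ : (t : ℕ) → (Fin t → unitInterval) → (Fin t → α) → Fin t → α := fun t =>
    Nat.rec (fun _ _ => Fin.elim0)
      (fun t Φt r x => Fin.snoc (Φt (Fin.init r) (Fin.init x))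
        (f t (Φt (Fin.init r) (Fin.init x), m (t + 1) x) (r (Fin.last t)))) t
  have hΦ : ∀ t r x, Φ (t + 1) r x = Fin.snoc (Φ t (Fin.init r) (Fin.init x))
      (f t (Φ t (Fin.init r) (Fin.init x), m (t + 1) x) (r (Fin.last t))) := fun t r x => rfl
  have hΦm : ∀ t, Measurable (Function.uncurry (Φ t)) := by
    intro t
    induction t with
    | zero => exact measurable_of_subsingleton_codomain _
    | succ t ih =>
      have h1 : Measurable fun p : (Fin (t + 1) → unitInterval) × (Fin (t + 1) → α) =>
          Φ t (Fin.init p.1) (Fin.init p.2) :=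
        ih.comp ((measurable_fin_init.comp measurable_fst).prodMk
          (measurable_fin_init.comp measurable_snd))
      have h2 : Measurable fun p : (Fin (t + 1) → unitInterval) × (Fin (t + 1) → α) =>
          f t (Φ t (Fin.init p.1) (Fin.init p.2), m (t + 1) p.2) (p.1 (Fin.last t)) :=
        (hf t).comp ((h1.prodMk ((hm (t + 1)).comp measurable_snd)).prodMk (by fun_prop))
      exact measurable_fin_snoc.comp (h1.prodMk h2)
  refine ⟨Φ, hΦm, fun t r x => by rw [hΦ, Fin.init_snoc], fun t => ?_⟩
  induction t with
  | zero =>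
    have e : (fun p : Ω × (Fin 0 → unitInterval) => (Φ 0 p.2 (h 0 p.1), Y p.1)) =
        (fun ω => (h' 0 ω, Y ω)) ∘ Prod.fst := by
      ext p i
      · exact i.elim0
      · rfl
    rw [e, ← Measure.map_map (by fun_prop) measurable_fst, Measure.map_fst_prod]
    simp
  | succ t ih =>
    let R : Measure (Fin t → unitInterval) := Measure.pi fun _ => volume
    have hpre := (measurePreserving_prodAssoc P R volume).symm.comp
      ((MeasurePreserving.id P).prod (measurePreserving_finInitLast
        (volume : Measure unitInterval) t))
    have hΦt : Measurable fun p : Ω × (Fin t → unitInterval) => Φ t p.2 (h t p.1) :=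
      (hΦm t).comp (measurable_snd.prodMk ((hh t).comp measurable_fst))
    have hN : Measurable fun p : Ω × (Fin t → unitInterval) => m (t + 1) (h (t + 1) p.1) := by
      have := hm (t + 1)
      have := hh (t + 1)
      fun_prop
    have hg : Measurable fun q : (Fin (t + 1) → α) × (Fin t → unitInterval) =>
        Φ t q.2 (Fin.init q.1) :=
      (hΦm t).comp (measurable_snd.prodMk (measurable_fin_init.comp measurable_fst))
    -- The simulated past of length `t` is a function of the real history of length `t + 1` and
    -- independent uniforms, so it adds nothing about `Y` to the posterior mean of period `t + 1`.
    have hrand := (hcond (t + 1)).randomize (hh _) hY (hm _) R hg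
    simp only [hinit] at hrand
    have hs := hsim t (P.prod R) (fun p => Φ t p.2 (h t p.1))
      (fun p => m (t + 1) (h (t + 1) p.1)) (fun p => Y p.1) hΦt hN (by fun_prop) ih hrand
    have hout : Measurable fun p : (Ω × (Fin t → unitInterval)) × unitInterval =>
        ((Φ t p.1.2 (h t p.1.1),
          f t (Φ t p.1.2 (h t p.1.1), m (t + 1) (h (t + 1) p.1.1)) p.2), Y p.1.1) :=
      ((hΦt.comp measurable_fst).prodMk ((hf t).comp
        (((hΦt.comp measurable_fst).prodMk (hN.comp measurable_fst)).prodMk measurable_snd))).prodMk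
        (by fun_prop)
    have hsn : Measurable fun p : ((Fin t → α) × α) × ℝ =>
        ((Fin.snoc p.1.1 p.1.2 : Fin (t + 1) → α), p.2) :=
      (measurable_fin_snoc.comp measurable_fst).prodMk measurable_snd
    have hs' := congrArg (Measure.map fun p : ((Fin t → α) × α) × ℝ =>
      ((Fin.snoc p.1.1 p.1.2 : Fin (t + 1) → α), p.2)) hs
    rw [← hpre.map_eq, Measure.map_map hout hpre.measurable,
      Measure.map_map hsn (hout.comp hpre.measurable), Measure.map_map hsn (by fun_prop)] at hs'
    convert hs' using 2
    · ext p : 1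
      refine Prod.ext ?_ rfl
      simp only [hΦ, hinit]
      rfl
    · ext ω : 1
      refine Prod.ext ?_ rfl
      change h' (t + 1) ω = Fin.snoc (h' t ω) (h' (t + 1) ω (Fin.last t))
      rw [← hinit' t ω]
      exact (Fin.snoc_init_self _).symm

/-- Consistent families of finite histories with the same laws have the same law as sequences. -/
lemma map_histories_eq {α β Ω' : Type*} [MeasurableSpace α] [MeasurableSpace β]
    [MeasurableSpace Ω'] {P' : Measure Ω'} [IsProbabilityMeasure P']
    {Y : Ω → β} {Y' : Ω' → β} (hY : Measurable Y) (hY' : Measurable Y')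
    {h : (t : ℕ) → Ω → Fin t → α} {h' : (t : ℕ) → Ω' → Fin t → α}
    (hh : ∀ t, Measurable (h t)) (hh' : ∀ t, Measurable (h' t))
    (hinit : ∀ t ω, Fin.init (h (t + 1) ω) = h t ω)
    (hinit' : ∀ t ω, Fin.init (h' (t + 1) ω) = h' t ω)
    (heq : ∀ t, P.map (fun ω => (h t ω, Y ω)) = P'.map fun ω => (h' t ω, Y' ω)) :
    P.map (fun ω => ((fun t => h t ω), Y ω)) = P'.map fun ω => ((fun t => h' t ω), Y' ω) := by
  let s : Ω → ℕ → α := fun ω n => h (n + 1) ω (Fin.last n)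
  let s' : Ω' → ℕ → α := fun ω n => h' (n + 1) ω (Fin.last n)
  have hs : Measurable s := by fun_prop
  have hs' : Measurable s' := by fun_prop
  have hseq : P.map (fun ω => (s ω, Y ω)) = P'.map fun ω => (s' ω, Y' ω) := by
    have := Measure.isProbabilityMeasure_map (μ := P)
      (by fun_prop : Measurable fun ω => (s ω, Y ω)).aemeasurable
    refine Measure.ext_prod_iff.2 fun {A C} hA hC => ?_
    -- On each event for `Y` the finite-dimensional marginals agree, and they determine the law of
    -- the sequence. Below, length `I.sup id + 1` covers all indices in `I`.
    have hlim : (P.restrict (Y ⁻¹' C)).map s = (P'.restrict (Y' ⁻¹' C)).map s' := by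
      refine IsProjectiveLimit.unique
        (P := fun I => ((P'.restrict (Y' ⁻¹' C)).map s').map I.restrict) (fun I => ?_)
        fun I => rfl
      let t := I.sup id + 1
      let π : (Fin t → α) → (i : I) → α := fun x i =>
        x ⟨i, Nat.lt_succ_of_le (Finset.le_sup (f := id) i.2)⟩
      have hπ : Measurable π := by fun_prop
      have e : I.restrict ∘ s = π ∘ h t := by
        ext ω i
        exact (apply_eq_last_of_init_eq hinit ω t ⟨i, _⟩).symm
      have e' : I.restrict ∘ s' = π ∘ h' t := by
        ext ω i
        exact (apply_eq_last_of_init_eq hinit' ω t ⟨i, _⟩).symm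
      beta_reduce
      rw [Measure.map_map (by fun_prop) hs, Measure.map_map (by fun_prop) hs', e, e']
      ext D hD
      have hc := congrArg (fun M => M ((π ⁻¹' D) ×ˢ C)) (heq t)
      simp only [Measure.map_apply ((hh t).prodMk hY) ((hπ hD).prod hC),
        Measure.map_apply ((hh' t).prodMk hY') ((hπ hD).prod hC)] at hc
      rw [Measure.map_apply (hπ.comp (hh t)) hD, Measure.map_apply (hπ.comp (hh' t)) hD,
        Measure.restrict_apply (hπ.comp (hh t) hD), Measure.restrict_apply (hπ.comp (hh' t) hD)]
      exact hc
    have := congrArg (fun M => M A) hlim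
    simp only [Measure.map_apply hs hA, Measure.map_apply hs' hA,
      Measure.restrict_apply (hs hA), Measure.restrict_apply (hs' hA)] at this
    rw [Measure.map_apply (by fun_prop) (hA.prod hC), Measure.map_apply (by fun_prop) (hA.prod hC)]
    exact this
  have := congrArg (Measure.map fun p : (ℕ → α) × β =>
    ((fun (t : ℕ) (i : Fin t) => p.1 i), p.2)) hseq
  rw [Measure.map_map (by fun_prop) (by fun_prop),
    Measure.map_map (by fun_prop) (by fun_prop)] at this
  convert this using 2
  · ext ω t i
    · exact apply_eq_last_of_init_eq hinit ω t i
    · rfl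
  · ext ω t i
    · exact apply_eq_last_of_init_eq hinit' ω t i
    · rfl

end Simulation

/-! ### Derandomization -/

/-- A value below the expected payoff of a randomized choice is attained by some choice. -/
lemma exists_le_sub_of_le_lintegral_sub {R : Type*} [MeasurableSpace R] (ρ : Measure R)
    [IsProbabilityMeasure ρ] {p n : R → ℝ≥0∞} (hp : Measurable p) (hn : Measurable n) (c : ℝ)
    (h : (c : EReal) ≤ ((∫⁻ r, p r ∂ρ : ℝ≥0∞) : EReal) - ((∫⁻ r, n r ∂ρ : ℝ≥0∞) : EReal)) :
    ∃ r, (c : EReal) ≤ (p r : EReal) - (n r : EReal) := by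
  by_contra! hlt
  -- In `EReal`, subtracting `⊤` gives `⊥` even from `⊤`, so a real lower bound makes the negative
  -- part integrable. The assumed strict inequality then bounds `p` and can be integrated.
  have hnfin : ∫⁻ r, n r ∂ρ ≠ ∞ := by
    intro h0
    rw [h0, EReal.coe_ennreal_top, EReal.sub_top] at h
    exact absurd h (by simp)
  have hnae : ∀ᵐ r ∂ρ, n r < ∞ := ae_lt_top hn hnfin
  have hpae : ∀ᵐ r ∂ρ, p r < ∞ ∧ (p r).toReal < (n r).toReal + c := by
    filter_upwards [hnae] with r hr
    have h1 := hlt r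
    have e : (n r : EReal) = ((n r).toReal : EReal) := (EReal.coe_ennreal_toReal hr.ne).symm
    have hpr : p r ≠ ∞ := by
      intro h0
      rw [h0, e, EReal.coe_ennreal_top, EReal.top_sub_coe] at h1
      exact absurd h1 (by simp)
    refine ⟨lt_top_iff_ne_top.2 hpr, ?_⟩
    rw [e, ← EReal.coe_ennreal_toReal hpr, ← EReal.coe_sub, EReal.coe_lt_coe_iff] at h1
    linarith
  have hnint : Integrable (fun r => (n r).toReal) ρ :=
    integrable_toReal_of_lintegral_ne_top hn.aemeasurable hnfin
  have hpint : Integrable (fun r => (p r).toReal) ρ := by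
    refine (hnint.add (integrable_const c)).mono'
      hp.ennreal_toReal.aestronglyMeasurable ?_
    filter_upwards [hpae] with r hr
    rw [Real.norm_of_nonneg ENNReal.toReal_nonneg]
    exact hr.2.le
  have hpint' : ∫⁻ r, p r ∂ρ = ENNReal.ofReal (∫ r, (p r).toReal ∂ρ) := by
    rw [ofReal_integral_eq_lintegral_ofReal hpint (ae_of_all _ fun _ => ENNReal.toReal_nonneg)]
    refine lintegral_congr_ae ?_
    filter_upwards [hpae] with r hr
    rw [ENNReal.ofReal_toReal hr.1.ne]
  have hnint' : ∫⁻ r, n r ∂ρ = ENNReal.ofReal (∫ r, (n r).toReal ∂ρ) := by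
    rw [ofReal_integral_eq_lintegral_ofReal hnint (ae_of_all _ fun _ => ENNReal.toReal_nonneg)]
    refine lintegral_congr_ae ?_
    filter_upwards [hnae] with r hr
    rw [ENNReal.ofReal_toReal hr.ne]
  have hpn : 0 ≤ ∫ r, (p r).toReal ∂ρ := integral_nonneg fun _ => ENNReal.toReal_nonneg
  have hnn : 0 ≤ ∫ r, (n r).toReal ∂ρ := integral_nonneg fun _ => ENNReal.toReal_nonneg
  rw [hpint', hnint', EReal.coe_ennreal_ofReal, EReal.coe_ennreal_ofReal, max_eq_left hpn,
    max_eq_left hnn, ← EReal.coe_sub, EReal.coe_le_coe_iff] at h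
  have hpos : 0 < ∫ r, ((n r).toReal + c - (p r).toReal) ∂ρ := by
    have hint := (hnint.add (integrable_const c)).sub hpint
    refine (integral_pos_iff_support_of_nonneg_ae ?_ hint).2 ?_
    · filter_upwards [hpae] with r hr
      simp only [Pi.zero_apply, Pi.sub_apply, Pi.add_apply]
      linarith [hr.2]
    · have : ∀ᵐ r ∂ρ, r ∈ Function.support fun r => (n r).toReal + c - (p r).toReal := by
        filter_upwards [hpae] with r hr
        rw [Function.mem_support]
        linarith [hr.2]
      refine pos_iff_ne_zero.2 fun h0 => ?_
      obtain ⟨r, h1, h2⟩ := (this.and (measure_eq_zero_iff_ae_notMem.1 h0)).exists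
      exact h2 h1
  have hint : ∫ r, ((n r).toReal + c - (p r).toReal) ∂ρ =
      ∫ r, (n r).toReal ∂ρ + c - ∫ r, (p r).toReal ∂ρ := by
    rw [integral_sub (f := fun r => (n r).toReal + c) (hnint.add (integrable_const c)) hpint,
      integral_add hnint (integrable_const c)]
    simp
  linarith

/-! ### The myopic strategy -/

lemma sum_blockCount {K B : ℕ} (s : Fin B → Fin K) : ∑ k, blockCount s k = B := by
  have := Finset.card_eq_sum_card_fiberwise (s := (Finset.univ : Finset (Fin B))) (f := s)
    (t := Finset.univ) fun _ _ => Finset.mem_coe.2 (Finset.mem_univ _)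
  rw [Finset.card_univ, Fintype.card_fin] at this
  exact this.symm

lemma AcqStrategy.sum_division {K B : ℕ} (S : AcqStrategy K B) (t : ℕ)
    (h : Fin t → Fin B → ℝ) : ∑ k, S.division t h k = t * B := by
  unfold AcqStrategy.division
  rw [Finset.sum_comm]
  simp [sum_blockCount]

/-- The strategy that follows a given sequence of sources. -/
def AcqStrategy.ofSeq {K : ℕ} (j : ℕ → Fin K) (B : ℕ) : AcqStrategy K B where
  choose t _ b := j (t * B + b)
  measurable_choose _ := measurable_const

lemma seqCount_add_block {K : ℕ} (j : ℕ → Fin K) (n B : ℕ) :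
    seqCount j (n + B) = seqCount j n + blockCount fun b : Fin B => j (n + b) := by
  ext k
  simp only [seqCount, blockCount, Finset.card_filter, Pi.add_apply, Finset.sum_range_add]
  rw [Fin.sum_univ_eq_sum_range (fun b => if j (n + b) = k then 1 else 0) B]

lemma AcqStrategy.division_ofSeq {K : ℕ} (j : ℕ → Fin K) (B t : ℕ) (h : Fin t → Fin B → ℝ) :
    (AcqStrategy.ofSeq j B).division t h = seqCount j (t * B) := by
  induction t with
  | zero => ext k; simp [AcqStrategy.division, seqCount]
  | succ t ih =>
    rw [Nat.succ_mul, seqCount_add_block, ← ih (Fin.init h)]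
    ext k
    simp only [AcqStrategy.division, Fin.sum_univ_castSucc, Pi.add_apply]
    rfl

namespace InfoEnv

variable {K : ℕ} (E : InfoEnv K)

lemma posteriorVar_nonneg [NeZero K] (q : Fin K → ℕ) : 0 ≤ E.posteriorVar q :=
  integral_nonneg_of_ae (condExp_nonneg (ae_of_all _ fun _ => sq_nonneg _))

/-- All blocks lead to the same total `t * B + B`, and the sequence minimizes over every vector with
that total, not only over extensions of the current one. -/
lemma isMyopic_ofSeq [NeZero K] {j : ℕ → Fin K}
    (hj : ∀ (n : ℕ) (q : Fin K → ℕ), ∑ i, q i = n →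
      E.posteriorVar (seqCount j n) ≤ E.posteriorVar q) (B : ℕ) :
    E.IsMyopic (AcqStrategy.ofSeq j B) := by
  intro t h s
  have e : (AcqStrategy.ofSeq j B).division t h + blockCount ((AcqStrategy.ofSeq j B).choose t h) =
      seqCount j (t * B + B) := by
    rw [AcqStrategy.division_ofSeq, seqCount_add_block]
    rfl
  rw [e]
  refine hj _ _ ?_
  simp only [Pi.add_apply, Finset.sum_add_distrib, AcqStrategy.sum_division, sum_blockCount]

variable {B : ℕ} {Act : ℕ → Type*} [∀ t, MeasurableSpace (Act t)]

lemma init_history (S : AcqStrategy K B) (t : ℕ) (ω) :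
    Fin.init (E.history S ω (t + 1)) = E.history S ω t :=
  Fin.init_snoc _ _

/-- Every strategy is matched by a randomized decision strategy along a sequence of sources that
minimizes the posterior variance. -/
lemma exists_randomized_decision [NeZero K] {j : ℕ → Fin K}
    (hj : ∀ (n : ℕ) (q : Fin K → ℕ), ∑ i, q i = n →
      E.posteriorVar (seqCount j n) ≤ E.posteriorVar q)
    (S' : AcqStrategy K B) (A' : DecisionStrategy B Act) :
    ∃ A : (ℕ → unitInterval) → DecisionStrategy B Act,
      ∀ U : ((t : ℕ) → Act t) → ℝ → ℝ, Measurable (Function.uncurry U) →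
        ∀ φ : ℝ → ℝ≥0∞, Measurable φ →
        Measurable (fun r => ∫⁻ ω, φ (E.payoff U (AcqStrategy.ofSeq j B) (A r) ω) ∂(E.law B)) ∧
        ∫⁻ r, ∫⁻ ω, φ (E.payoff U (AcqStrategy.ofSeq j B) (A r) ω) ∂(E.law B)
            ∂(Measure.infinitePi fun _ : ℕ => (volume : Measure unitInterval)) =
          ∫⁻ ω, φ (E.payoff U S' A' ω) ∂(E.law B) := by
  let S := AcqStrategy.ofSeq j B
  let ρ : Measure (ℕ → unitInterval) := Measure.infinitePi fun _ : ℕ => volume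
  have hY : Measurable fun ω : EuclideanSpace ℝ (Fin K) × (ℕ → Fin B → Fin K → ℝ) => ω.1 0 := by
    fun_prop
  choose m hm _ hcond using E.exists_condGaussian_history S
  choose m' hm' hv' hcond' using E.exists_condGaussian_history S'
  -- Following a sequence makes the division independent of the history, hence the variance
  -- constant, as `exists_simulation` requires.
  simp only [S, AcqStrategy.division_ofSeq] at hcond
  obtain ⟨Φ, hΦ, hΦinit, hΦlaw⟩ := exists_simulation hY (E.measurable_history S)
    (E.measurable_history S') (E.init_history S) (E.init_history S') hm hm' hv' hcond hcond'
    (fun t => E.posteriorVar_nonneg _) fun t x => hj _ _ (S'.sum_division t x)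
  let trunc : (t : ℕ) → (ℕ → unitInterval) → Fin t → unitInterval := fun t r i => r i
  have htrunc : ∀ t, ρ.map (trunc t) = Measure.pi fun _ => volume := fun t => by
    rw [← Measure.infinitePi_eq_pi]
    exact Measure.map_infinitePi_infinitePi_of_inj Fin.val_injective
  have htm : ∀ t, Measurable (trunc t) := fun t => by fun_prop
  have hsim : ∀ t, Measurable
      fun p : (EuclideanSpace ℝ (Fin K) × (ℕ → Fin B → Fin K → ℝ)) × (ℕ → unitInterval) =>
        Φ t (trunc t p.2) (E.history S p.1 t) := fun t =>
    (hΦ t).comp (((htm t).comp measurable_snd).prodMk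
      ((E.measurable_history S t).comp measurable_fst))
  have hlaw : ∀ t, ((E.law B).prod ρ).map
      (fun p => (Φ t (trunc t p.2) (E.history S p.1 t), p.1.1 0)) =
      (E.law B).map fun ω => (E.history S' ω t, ω.1 0) := by
    intro t
    have h1 := hΦlaw t
    have h2 := Measure.map_prod_map (E.law B) ρ measurable_id (htm t)
    rw [Measure.map_id, htrunc] at h2
    have h3 : Measurable fun p : (EuclideanSpace ℝ (Fin K) × (ℕ → Fin B → Fin K → ℝ)) ×
        (Fin t → unitInterval) => (Φ t p.2 (E.history S p.1 t), p.1.1 0) :=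
      ((hΦ t).comp (measurable_snd.prodMk
        ((E.measurable_history S t).comp measurable_fst))).prodMk (by fun_prop)
    rw [h2, Measure.map_map h3 (measurable_id.prodMap (htm t))] at h1
    exact h1
  have hseq := map_histories_eq (by fun_prop) hY hsim (E.measurable_history S')
    (fun t p => by rw [hΦinit, E.init_history]; rfl) (E.init_history S') hlaw
  let A : (ℕ → unitInterval) → DecisionStrategy B Act := fun r =>
    { act := fun t x => A'.act t (Φ (t + 1) (trunc (t + 1) r) x)
      measurable_act := fun t => (A'.measurable_act t).comp ((hΦ (t + 1)).comp
        (measurable_const.prodMk measurable_id)) }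
  refine ⟨A, fun U hU φ hφ => ?_⟩
  -- The payoff depends only on the histories and the relevant state, so equality of their joint
  -- laws suffices; Tonelli separates the randomization. The general `φ` serves both the positive
  -- and the negative part.
  let V : ((t : ℕ) → Fin t → Fin B → ℝ) × ℝ → ℝ≥0∞ := fun p =>
    φ (U (fun t => A'.act t (p.1 (t + 1))) p.2)
  have hV : Measurable V := by
    refine hφ.comp (hU.comp (Measurable.prodMk (measurable_pi_lambda _ fun t => ?_)
      measurable_snd))
    exact (A'.measurable_act t).comp ((measurable_pi_apply (t + 1)).comp measurable_fst)
  have hpair : Measurable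
      fun p : (EuclideanSpace ℝ (Fin K) × (ℕ → Fin B → Fin K → ℝ)) × (ℕ → unitInterval) =>
        ((fun t => Φ t (trunc t p.2) (E.history S p.1 t)), p.1.1 0) :=
    (measurable_pi_lambda _ hsim).prodMk (by fun_prop)
  have hpair' : Measurable fun ω => ((fun t => E.history S' ω t), ω.1 0) :=
    (measurable_pi_lambda _ (E.measurable_history S')).prodMk hY
  have h1 := congrArg (fun M => ∫⁻ x, V x ∂M) hseq
  simp only [lintegral_map hV hpair, lintegral_map hV hpair'] at h1
  exact ⟨(hV.comp hpair).lintegral_prod_left',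
    (lintegral_prod_symm _ (hV.comp hpair).aemeasurable).symm.trans h1⟩

end InfoEnv

end

/-! ### The theorem -/

theorem theorem2 {K : ℕ} [NeZero K] (E : InfoEnv K) (hE : E.NonRedundant)
    (hsep : E.Separable) (B : ℕ) (hB : 0 < B) :
    ∃ S : AcqStrategy K B, E.IsMyopic S ∧
      ∀ (Act : ℕ → Type*) [∀ t, MeasurableSpace (Act t)]
        (U : ((t : ℕ) → Act t) → ℝ → ℝ), Measurable (Function.uncurry U) →
        (∀ (S' : AcqStrategy K B) (A' : DecisionStrategy B Act),
          E.expectedPayoff U S' A' ≤ ⨆ A : DecisionStrategy B Act, E.expectedPayoff U S A) ∧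
        (∀ (S' : AcqStrategy K B) (A' : DecisionStrategy B Act), E.expectedPayoff U S' A' ≠ ⊤ →
          ∃ A : DecisionStrategy B Act, E.expectedPayoff U S' A' ≤ E.expectedPayoff U S A) ∧
        ((∃ (S' : AcqStrategy K B) (A' : DecisionStrategy B Act),
            E.IsOptimal U S' A' ∧ E.expectedPayoff U S' A' ≠ ⊤) →
          ∃ A : DecisionStrategy B Act, E.IsOptimal U S A) := by
  obtain ⟨j, hj⟩ := hsep.exists_seqCount_minimizes
  refine ⟨AcqStrategy.ofSeq j B, E.isMyopic_ofSeq hj B, fun Act _ U hU => ?_⟩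
  -- Derandomization transfers real lower bounds only. A finite value is its own bound and `⊥` is
  -- trivial, while `⊤` is reached through all real `c`, as a supremum.
  have key : ∀ (S' : AcqStrategy K B) (A' : DecisionStrategy B Act) (c : ℝ),
      (c : EReal) ≤ E.expectedPayoff U S' A' →
      ∃ A, (c : EReal) ≤ E.expectedPayoff U (AcqStrategy.ofSeq j B) A := by
    intro S' A' c hc
    obtain ⟨A, hA⟩ := E.exists_randomized_decision hj S' A'
    have hp := hA U hU ENNReal.ofReal ENNReal.measurable_ofReal
    have hn := hA U hU (fun x => ENNReal.ofReal (-x))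
      (ENNReal.measurable_ofReal.comp measurable_neg)
    rw [InfoEnv.expectedPayoff, ← hp.2, ← hn.2] at hc
    obtain ⟨r, hr⟩ := exists_le_sub_of_le_lintegral_sub _ hp.1 hn.1 c hc
    exact ⟨A r, hr⟩
  have attain : ∀ (S' : AcqStrategy K B) (A' : DecisionStrategy B Act),
      E.expectedPayoff U S' A' ≠ ⊤ →
      ∃ A, E.expectedPayoff U S' A' ≤ E.expectedPayoff U (AcqStrategy.ofSeq j B) A := by
    intro S' A' htop
    by_cases hbot : E.expectedPayoff U S' A' = ⊥
    · exact ⟨A', hbot ▸ bot_le⟩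
    · have e := EReal.coe_toReal htop hbot
      obtain ⟨A, hA⟩ := key S' A' _ e.le
      exact ⟨A, e ▸ hA⟩
  refine ⟨fun S' A' => ?_, attain, ?_⟩
  · refine EReal.ge_of_forall_gt_iff_ge.1 fun c hc => ?_
    obtain ⟨A, hA⟩ := key S' A' c hc.le
    exact hA.trans (le_iSup (fun A => E.expectedPayoff U (AcqStrategy.ofSeq j B) A) A)
  · rintro ⟨S', A', hopt, htop⟩
    obtain ⟨A, hA⟩ := attain S' A' htop
    exact ⟨A, fun S'' A'' => (hopt S'' A'').trans hA⟩
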